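/- **Theorem 1 (point symmetry classification).** Consider the equation $$\Delta_f:\quad u_t+\big(u(uu_x)_x+f(u)\big)_x=0 .$$ Let $\Omega\subseteq\mathbb R^3$ be a connected open set of points $(t,x,u)$ that contains a point with $u>0$, let $I=\{u : (t,x,u)\in\Omega\}$, and let $f$ be a real function that is smooth ($C^\infty$) on $I$ and whose derivative $f'$ is not identically zero on $I$. A point symmetry of $\Delta_f$ on $\Omega$ is a smooth vector field $X=\tau(t,x,u)\partial_t+\xi(t,x,u)\partial_x+\eta(t,x,u)\partial_u$ on $\Omega$ whose third prolongation annihilates the left-hand side of the equation at every jet over $\Omega$ that satisfies the equation. "Generated by" means: equal on $\Omega$ to a linear combination with real constant coefficients. Put $$\mathbf X_1=\partial_t,\qquad \mathbf X_2=\partial_x .$$ 1. The vector fields that are point symmetries of $\Delta_f$ on $\Omega$ for every such $f$ are exactly those generated by $\mathbf X_1,\mathbf X_2$. 2. For a given such $f$, the equation $\Delta_f$ admits a point symmetry on $\Omega$ that is not generated by $\mathbf X_1,\mathbf X_2$ if and only if, for all $u\in I$, $f(u)$ has one of the forms (a), (b), (c) below with real constants $n\neq0$, $f_0\neq0$, $f_1$,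 $f_2$: (a) $f(u)=f_0u^n+f_1u+f_2$. Then $$\mathbf X_3=(3n-5)t\,\partial_t+\big((n-3)x+2f_1(n-1)t\big)\partial_x-2u\,\partial_u$$ is a point symmetry that is not generated by $\mathbf X_1,\mathbf X_2$. If $n\ne1$, the point symmetries are exactly the vector fields generated by $\mathbf X_1,\mathbf X_2,\mathbf X_3$. If $n=1$ and $f_1=0$ (every linear $f$ can be written so), they are exactly those generated by $\mathbf X_1,\mathbf X_2,\mathbf X_3,\mathbf X_4$, where $$\mathbf X_4=2(x-f_0t)\,\partial_x+3u\,\partial_u$$ is not generated by $\mathbf X_1,\mathbf X_2,\mathbf X_3$. (b) $f(u)=f_0u\ln u+f_1u+f_2$. Then the point symmetries are exactly the vector fields generated by $\mathbf X_1,\mathbf X_2$ and $$\mathbf X_5=t\,\partial_t+(x+f_0t)\,\partial_x+u\,\partial_u ,$$ and $\mathbf X_5$ is not generated by $\mathbf X_1,\mathbf X_2$. (c) $f(u)=f_0\ln u+f_1u+f_2$. Then the point symmetries are exactly the vector fields generated by $\mathbf X_1,\mathbf X_2$ and $$\mathbf X_6=5t\,\partial_t+(3x+2f_1t)\,\partial_x+2u\,\partial_u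 ,$$ and $\mathbf X_6$ is not generated by $\mathbf X_1,\mathbf X_2$. (If $0\in I$, smoothness of $f$ excludes (b) and (c) and forces $n$ in (a) to be a positive integer.) -/

import Mathlib

open scoped ContDiff

namespace QuasilinearKdV

/-- The space of independent and dependent variables: a point is `(t, x, u)`. -/
abbrev Pt := ℝ × ℝ × ℝ

/-- A jet of a function `u(t, x)`: a point `(t, x, w)`, where the coordinate `w i k` stands for the
derivative of `u` taken `i` times in `t` and `k` times in `x`. So `w 0 0` is `u`, `w 1 0` is `u_t`,
`w 0 1` is `u_x`, and so on. -/
abbrev Jet := ℝ × ℝ × (ℕ → ℕ → ℝ)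

/-- The point `(t, x, u)` below a jet. -/
def base (j : Jet) : Pt := (j.1, j.2.1, j.2.2 0 0)

/-- The coordinate function `u` on jets. -/
def uCoord (j : Jet) : ℝ := j.2.2 0 0

/-- The total derivative `D_t = ∂_t + ∑ u_{i+1,k} ∂/∂u_{i,k}` of a function on jets, as the
directional derivative along that vector field. -/
noncomputable def Dt (F : Jet → ℝ) (j : Jet) : ℝ :=
  lineDeriv ℝ F j (1, 0, fun i k => j.2.2 (i + 1) k)

/-- The total derivative `D_x = ∂_x + ∑ u_{i,k+1} ∂/∂u_{i,k}` of a function on jets. -/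
noncomputable def Dx (F : Jet → ℝ) (j : Jet) : ℝ :=
  lineDeriv ℝ F j (0, 1, fun i k => j.2.2 i (k + 1))

/-- The left-hand side `u_t + (u (u u_x)_x + f(u))_x` of the equation, as a function on jets. -/
noncomputable def kdv (f : ℝ → ℝ) : Jet → ℝ :=
  Dt uCoord +
    Dx (uCoord * Dx (uCoord * Dx uCoord) + fun j => f (uCoord j))

/-- The characteristic `η - τ u_t - ξ u_x` of the vector field
`X = τ(t,x,u) ∂_t + ξ(t,x,u) ∂_x + η(t,x,u) ∂_u`. -/
def characteristic (X : Pt → Pt) (j : Jet) : ℝ :=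
  (X (base j)).2.2 - (X (base j)).1 * j.2.2 1 0 - (X (base j)).2.1 * j.2.2 0 1

/-- The prolongation of `X` to jets: its component along `u_{i,k}` is
`D_t^i D_x^k (η - τ u_t - ξ u_x) + τ u_{i+1,k} + ξ u_{i,k+1}`. -/
noncomputable def prolongation (X : Pt → Pt) (j : Jet) : Jet :=
  ((X (base j)).1, (X (base j)).2.1, fun i k =>
    (Dt^[i] (Dx^[k] (characteristic X))) j
      + (X (base j)).1 * j.2.2 (i + 1) k + (X (base j)).2.1 * j.2.2 i (k + 1))

/-- `X`, a smooth vector field on the open set `Ω`, is an (infinitesimal) point symmetry of the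
equation: the derivative of the left-hand side of the equation along the prolongation of `X`
vanishes at every jet over `Ω` that satisfies the equation. As the left-hand side is a function of
third order, only the third prolongation enters. -/
def IsPointSymmetry (f : ℝ → ℝ) (Ω : Set Pt) (X : Pt → Pt) : Prop :=
  ContDiffOn ℝ ∞ X Ω ∧
    ∀ j : Jet, base j ∈ Ω → kdv f j = 0 → lineDeriv ℝ (kdv f) j (prolongation X j) = 0

/-- The vector fields which on `Ω` are real linear combinations of the fields in `S`. -/
def generatedOn (Ω : Set Pt) (S : Set (Pt → Pt)) : Set (Pt → Pt) :=
  {X | ∃ Y ∈ Submodule.span ℝ S, Set.EqOn X Y Ω}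

/-- The set of values that `u` takes on `Ω`. -/
def uRange (Ω : Set Pt) : Set ℝ := (fun p : Pt => p.2.2) '' Ω

/-- The functions `f` that may stand in the equation over `Ω`: smooth, with `f'` not identically
zero. -/
def Admissible (Ω : Set Pt) (f : ℝ → ℝ) : Prop :=
  ContDiffOn ℝ ∞ f (uRange Ω) ∧ ∃ u ∈ uRange Ω, deriv f u ≠ 0

/-- `f(u) = f₀ u^n + f₁ u + f₂` over `Ω`. -/
def IsPower (Ω : Set Pt) (f : ℝ → ℝ) (n f₀ f₁ f₂ : ℝ) : Prop :=
  n ≠ 0 ∧ f₀ ≠ 0 ∧ ∀ u ∈ uRange Ω, f u = f₀ * u ^ n + f₁ * u + f₂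

/-- `f(u) = f₀ u ln u + f₁ u + f₂` over `Ω`. -/
def IsULog (Ω : Set Pt) (f : ℝ → ℝ) (f₀ f₁ f₂ : ℝ) : Prop :=
  f₀ ≠ 0 ∧ ∀ u ∈ uRange Ω, f u = f₀ * u * Real.log u + f₁ * u + f₂

/-- `f(u) = f₀ ln u + f₁ u + f₂` over `Ω`. -/
def IsLog (Ω : Set Pt) (f : ℝ → ℝ) (f₀ f₁ f₂ : ℝ) : Prop :=
  f₀ ≠ 0 ∧ ∀ u ∈ uRange Ω, f u = f₀ * Real.log u + f₁ * u + f₂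

/-- `∂_t` -/
def X₁ : Pt → Pt := fun _ => (1, 0, 0)

/-- `∂_x` -/
def X₂ : Pt → Pt := fun _ => (0, 1, 0)

/-- `(3n - 5) t ∂_t + ((n - 3) x + 2 f₁ (n - 1) t) ∂_x - 2 u ∂_u` -/
def X₃ (n f₁ : ℝ) : Pt → Pt := fun (t, x, u) =>
  ((3 * n - 5) * t, (n - 3) * x + 2 * f₁ * (n - 1) * t, -2 * u)

/-- `2 (x - f₀ t) ∂_x + 3 u ∂_u` -/
def X₄ (f₀ : ℝ) : Pt → Pt := fun (t, x, u) => (0, 2 * (x - f₀ * t), 3 * u)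

/-- `t ∂_t + (x + f₀ t) ∂_x + u ∂_u` -/
def X₅ (f₀ : ℝ) : Pt → Pt := fun (t, x, u) => (t, x + f₀ * t, u)

/-- `5 t ∂_t + (3 x + 2 f₁ t) ∂_x + 2 u ∂_u` -/
def X₆ (f₁ : ℝ) : Pt → Pt := fun (t, x, u) => (5 * t, 3 * x + 2 * f₁ * t, 2 * u)

end QuasilinearKdV

/-! On the equation `u_t` is determined by `u, u_x, u_xx, u_xxx`, while these coordinates and `u_tx,
u_txx` are free. So the symmetry condition is a polynomial identity in the free coordinates
(`isPointSymmetry_iff_determining`), and its coefficients can be read off. The coefficient of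
`u_txx` makes `τ` depend on `t` alone. The coefficient of `u_xxx` gives `ξ_u = 0` and `η = a u` with
`2a = 3ξ_x - τ_t`. The coefficient of `u_xx` gives `ξ_xx = 0`, hence `a_x = 0`, and the part free of
derivatives gives `a_t = 0`. What remains is `ξ_t = 2(ξ_x - a) f' + a u f''`. As `ξ_x` and `a` do
not depend on `x`, this yields `ξ_tx = 0` and then `ξ_tt = 0`. On a connected domain `a`, `b = ξ_x`
and `k = ξ_t` are therefore constants. Thus symmetries are affine fields, translations aside given
by triples `(a, b, k)` with `2(b - a) f' + a u f'' = k` on the range of `u` (`isPointSymmetry_iff`).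
Both halves of the classification are about this relation. If a nonzero triple satisfies it, `f'` is
constant or solves an Euler equation `u h' = m h + κ`, whose solutions integrate to the three forms
(`exists_form_of_structureRelation`). The delicate point is `u = 0`: smoothness there allows only
exponents `m ∈ ℕ`, and an interval that avoids zero is positive. Conversely, for a given form the
relation is a linear system for `(a, b, k)`. If `f'` is not constant it is, up to constants, a
multiple of `u^(n-1)`, `ln u` or `1/u`, each independent of `1`, so the solution space is a line. If
`f'` is constant only `k = 2(b - a) f'` remains, a plane. -/

namespace QuasilinearKdV

/-! ### Partial derivatives on the point space and line derivatives on the jet space. -/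

/-- The derivative of `A` in the direction `v`, as a function of the point. -/
noncomputable def dirD (v : Pt) (A : Pt → ℝ) (p : Pt) : ℝ := fderiv ℝ A p v

/-- The coordinate directions of `t`, `x` and `u`. -/
abbrev eT : Pt := (1, 0, 0)
abbrev eX : Pt := (0, 1, 0)
abbrev eU : Pt := (0, 0, 1)

/-- The direction of the total derivative `D_x` at a jet. -/
abbrev xDir (j : Jet) : Jet := (0, 1, fun i k => j.2.2 i (k + 1))

/-- The direction of the total derivative `D_t` at a jet. -/
abbrev tDir (j : Jet) : Jet := (1, 0, fun i k => j.2.2 (i + 1) k)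

theorem ContDiffOn.dirD {Ω : Set Pt} (hΩ : IsOpen Ω) {A : Pt → ℝ} (hA : ContDiffOn ℝ ∞ A Ω)
    (v : Pt) : ContDiffOn ℝ ∞ (dirD v A) Ω :=
  (hA.fderiv_of_isOpen hΩ (m := ∞) (by simp)).clm_apply contDiffOn_const

theorem ContDiffOn.differentiableAt_of_isOpen {E : Type*} [NormedAddCommGroup E] [NormedSpace ℝ E]
    {s : Set E} (hs : IsOpen s) {A : E → ℝ} (hA : ContDiffOn ℝ ∞ A s) {p : E} (hp : p ∈ s) :
    DifferentiableAt ℝ A p :=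
  (hA.differentiableOn (by simp)).differentiableAt (hs.mem_nhds hp)

theorem two_le_infty : (2 : WithTop ℕ∞) ≤ ∞ :=
  WithTop.coe_le_coe.2 (le_top : (2 : ℕ∞) ≤ ⊤)

theorem dirD_comm {Ω : Set Pt} (hΩ : IsOpen Ω) {A : Pt → ℝ} (hA : ContDiffOn ℝ ∞ A Ω)
    (v w : Pt) {p : Pt} (hp : p ∈ Ω) : dirD v (dirD w A) p = dirD w (dirD v A) p := by
  have h1 : ContDiffAt ℝ ∞ A p := hA.contDiffAt (hΩ.mem_nhds hp)
  have h2 : DifferentiableAt ℝ (fderiv ℝ A) p :=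
    ((h1.fderiv_right (m := 1) (by rw [one_add_one_eq_two]; exact two_le_infty)).differentiableAt (by simp))
  have key (a b : Pt) : dirD a (dirD b A) p = fderiv ℝ (fderiv ℝ A) p a b := by
    unfold dirD
    rw [fderiv_clm_apply h2 (differentiableAt_const b)]
    simp
  rw [key, key]
  exact (h1.isSymmSndFDerivAt (by simpa using two_le_infty)).eq v w

theorem dirD_congr {Ω : Set Pt} (hΩ : IsOpen Ω) {A B : Pt → ℝ} (h : Set.EqOn A B Ω) (v : Pt) :
    Set.EqOn (dirD v A) (dirD v B) Ω := fun p hp => by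
  unfold dirD
  rw [(h.eventuallyEq_of_mem (hΩ.mem_nhds hp)).fderiv_eq]

theorem dirD_add_smul (A : Pt → ℝ) (p : Pt) (a b c : ℝ) :
    fderiv ℝ A p (a, b, c) = a * dirD eT A p + b * dirD eX A p + c * dirD eU A p := by
  have : ((a, b, c) : Pt) = a • eT + b • eX + c • eU := by simp
  rw [this]; simp only [map_add, map_smul, smul_eq_mul, dirD]

/-- Since `base` is linear, a line in the jet space projects to a line in `Pt`, where the Fréchet
derivative of `A` applies. Jets themselves form an infinite product, so only derivatives along lines
are used there. -/
theorem hasLineDerivAt_comp_base {A : Pt → ℝ} {j : Jet} (hA : DifferentiableAt ℝ A (base j))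
    (v : Jet) :
    HasLineDerivAt ℝ (fun j => A (base j))
      (v.1 * dirD eT A (base j) + v.2.1 * dirD eX A (base j) + v.2.2 0 0 * dirD eU A (base j))
      j v := by
  rw [← dirD_add_smul]
  exact hA.hasFDerivAt.hasLineDerivAt (base v)

theorem hasLineDerivAt_coord (i k : ℕ) (j v : Jet) :
    HasLineDerivAt ℝ (fun j : Jet => j.2.2 i k) (v.2.2 i k) j v := by
  have : HasDerivAt (fun t : ℝ => j.2.2 i k + t * v.2.2 i k) (1 * v.2.2 i k) 0 :=
    ((hasDerivAt_id (0 : ℝ)).mul_const _).const_add _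
  simpa [HasLineDerivAt] using this

theorem hasLineDerivAt_mul {F G : Jet → ℝ} {F' G' : ℝ} {j v : Jet}
    (hF : HasLineDerivAt ℝ F F' j v) (hG : HasLineDerivAt ℝ G G' j v) :
    HasLineDerivAt ℝ (fun j => F j * G j) (F' * G j + F j * G') j v := by
  have := HasDerivAt.mul hF hG
  simp only [zero_smul, add_zero] at this
  exact this

theorem hasLineDerivAt_add {F G : Jet → ℝ} {F' G' : ℝ} {j v : Jet}
    (hF : HasLineDerivAt ℝ F F' j v) (hG : HasLineDerivAt ℝ G G' j v) :
    HasLineDerivAt ℝ (fun j => F j + G j) (F' + G') j v := HasDerivAt.add hF hG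

theorem hasLineDerivAt_sub {F G : Jet → ℝ} {F' G' : ℝ} {j v : Jet}
    (hF : HasLineDerivAt ℝ F F' j v) (hG : HasLineDerivAt ℝ G G' j v) :
    HasLineDerivAt ℝ (fun j => F j - G j) (F' - G') j v := HasDerivAt.sub hF hG

theorem hasLineDerivAt_const (c : ℝ) (j v : Jet) :
    HasLineDerivAt ℝ (fun _ : Jet => c) 0 j v := hasDerivAt_const _ _

theorem hasLineDerivAt_comp_u {g : ℝ → ℝ} {j : Jet} (hg : DifferentiableAt ℝ g (j.2.2 0 0))
    (v : Jet) :
    HasLineDerivAt ℝ (fun j : Jet => g (j.2.2 0 0)) (deriv g (j.2.2 0 0) * v.2.2 0 0) j v := by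
  have h := hasLineDerivAt_coord 0 0 j v
  have hg' : HasDerivAt g (deriv g (j.2.2 0 0)) ((j + (0 : ℝ) • v).2.2 0 0) := by
    simpa using hg.hasDerivAt
  exact HasDerivAt.comp (0 : ℝ) hg' h

/-- A line through `j` stays over the open set `Ω` for small parameters. This is what lets formulas
valid only over `Ω` be differentiated again. -/
theorem lineDeriv_congr {Ω : Set Pt} (hΩ : IsOpen Ω) {F G : Jet → ℝ}
    (h : ∀ j, base j ∈ Ω → F j = G j) {j : Jet} (hj : base j ∈ Ω) (v : Jet) :
    lineDeriv ℝ F j v = lineDeriv ℝ G j v := by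
  apply Filter.EventuallyEq.deriv_eq
  have hc : Continuous fun t : ℝ => base (j + t • v) := by
    simp only [base, Prod.fst_add, Prod.snd_add, Prod.smul_fst, Prod.smul_snd, Pi.add_apply,
      Pi.smul_apply]
    fun_prop
  have := hc.continuousAt.preimage_mem_nhds (x := 0) (hΩ.mem_nhds (by simpa using hj))
  filter_upwards [this] with t ht using h _ ht

/-! ### Total derivatives and the characteristic. -/

/-- The first, second and third total `x`-derivatives of a function of `(t, x, u)`. -/
noncomputable def totalX (A : Pt → ℝ) (j : Jet) : ℝ :=
  dirD eX A (base j) + dirD eU A (base j) * j.2.2 0 1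

noncomputable def totalXX (A : Pt → ℝ) (j : Jet) : ℝ :=
  dirD eX (dirD eX A) (base j) + 2 * dirD eX (dirD eU A) (base j) * j.2.2 0 1
    + dirD eU (dirD eU A) (base j) * j.2.2 0 1 ^ 2 + dirD eU A (base j) * j.2.2 0 2

noncomputable def totalXXX (A : Pt → ℝ) (j : Jet) : ℝ :=
  dirD eX (dirD eX (dirD eX A)) (base j) + 3 * dirD eX (dirD eX (dirD eU A)) (base j) * j.2.2 0 1
    + 3 * dirD eX (dirD eU (dirD eU A)) (base j) * j.2.2 0 1 ^ 2
    + dirD eU (dirD eU (dirD eU A)) (base j) * j.2.2 0 1 ^ 3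
    + 3 * (dirD eX (dirD eU A) (base j) + dirD eU (dirD eU A) (base j) * j.2.2 0 1) * j.2.2 0 2
    + dirD eU A (base j) * j.2.2 0 3

section
variable {Ω : Set Pt} (hΩ : IsOpen Ω) {A : Pt → ℝ} (hA : ContDiffOn ℝ ∞ A Ω) {j : Jet}
  (hj : base j ∈ Ω)
include hΩ hA hj

theorem hasLineDerivAt_base_x :
    HasLineDerivAt ℝ (fun j => A (base j)) (totalX A j) j (xDir j) := by
  have := hasLineDerivAt_comp_base (ContDiffOn.differentiableAt_of_isOpen hΩ hA hj) (xDir j)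
  convert this using 1
  simp only [totalX]; ring

theorem hasLineDerivAt_totalX :
    HasLineDerivAt ℝ (totalX A) (totalXX A j) j (xDir j) := by
  have hX := hasLineDerivAt_base_x hΩ (ContDiffOn.dirD hΩ hA eX) hj
  have hU := hasLineDerivAt_base_x hΩ (ContDiffOn.dirD hΩ hA eU) hj
  have := hasLineDerivAt_add hX (hasLineDerivAt_mul hU (hasLineDerivAt_coord 0 1 j (xDir j)))
  convert this using 1
  · rfl
  · simp only [totalX, totalXX, dirD_comm hΩ hA eU eX hj]; ring

theorem hasLineDerivAt_totalXX :
    HasLineDerivAt ℝ (totalXX A) (totalXXX A j) j (xDir j) := by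
  have hU := ContDiffOn.dirD hΩ hA eU
  have hXX := hasLineDerivAt_base_x hΩ (ContDiffOn.dirD hΩ (ContDiffOn.dirD hΩ hA eX) eX) hj
  have hXU := hasLineDerivAt_base_x hΩ (ContDiffOn.dirD hΩ hU eX) hj
  have hUU := hasLineDerivAt_base_x hΩ (ContDiffOn.dirD hΩ hU eU) hj
  have hq := hasLineDerivAt_coord 0 1 j (xDir j)
  have hr := hasLineDerivAt_coord 0 2 j (xDir j)
  have := hasLineDerivAt_add (hasLineDerivAt_add (hasLineDerivAt_add hXX
    (hasLineDerivAt_mul (hasLineDerivAt_mul (hasLineDerivAt_const 2 _ _) hXU) hq))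
    (hasLineDerivAt_mul hUU (hasLineDerivAt_mul hq hq)))
    (hasLineDerivAt_mul (hasLineDerivAt_base_x hΩ hU hj) hr)
  have e1 : dirD eU (dirD eX (dirD eX A)) (base j) = dirD eX (dirD eX (dirD eU A)) (base j) := by
    rw [dirD_comm hΩ (ContDiffOn.dirD hΩ hA eX) eU eX hj]
    exact dirD_congr hΩ (fun p hp => dirD_comm hΩ hA eU eX hp) eX hj
  convert this using 1
  · ext j; simp only [totalXX]; ring
  · simp only [totalX, totalXXX, e1, dirD_comm hΩ hU eU eX hj]; ring

theorem hasLineDerivAt_base_t :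
    HasLineDerivAt ℝ (fun j => A (base j)) (dirD eT A (base j) + dirD eU A (base j) * j.2.2 1 0)
      j (tDir j) := by
  have := hasLineDerivAt_comp_base (ContDiffOn.differentiableAt_of_isOpen hΩ hA hj) (tDir j)
  convert this using 1
  ring

end

/-- The components of a vector field along `∂_t`, `∂_x` and `∂_u`. -/
def compT (X : Pt → Pt) (p : Pt) : ℝ := (X p).1
def compX (X : Pt → Pt) (p : Pt) : ℝ := (X p).2.1
def compU (X : Pt → Pt) (p : Pt) : ℝ := (X p).2.2

section
variable {Ω : Set Pt} {X : Pt → Pt}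

theorem contDiffOn_compT (hX : ContDiffOn ℝ ∞ X Ω) : ContDiffOn ℝ ∞ (compT X) Ω :=
  contDiff_fst.comp_contDiffOn hX

theorem contDiffOn_compX (hX : ContDiffOn ℝ ∞ X Ω) : ContDiffOn ℝ ∞ (compX X) Ω :=
  (contDiff_fst.comp contDiff_snd).comp_contDiffOn hX

theorem contDiffOn_compU (hX : ContDiffOn ℝ ∞ X Ω) : ContDiffOn ℝ ∞ (compU X) Ω :=
  (contDiff_snd.comp contDiff_snd).comp_contDiffOn hX

variable (hΩ : IsOpen Ω) (hX : ContDiffOn ℝ ∞ X Ω) {j : Jet} (hj : base j ∈ Ω)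

include hΩ hX hj

theorem Dt_characteristic : Dt (characteristic X) j =
    (dirD eT (compU X) (base j) + dirD eU (compU X) (base j) * j.2.2 1 0)
    - ((dirD eT (compT X) (base j) + dirD eU (compT X) (base j) * j.2.2 1 0) * j.2.2 1 0
      + compT X (base j) * j.2.2 2 0)
    - ((dirD eT (compX X) (base j) + dirD eU (compX X) (base j) * j.2.2 1 0) * j.2.2 0 1
      + compX X (base j) * j.2.2 1 1) := by
  have hT := hasLineDerivAt_base_t hΩ (contDiffOn_compT hX) hj
  have hXX := hasLineDerivAt_base_t hΩ (contDiffOn_compX hX) hj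
  have hU := hasLineDerivAt_base_t hΩ (contDiffOn_compU hX) hj
  exact (hasLineDerivAt_sub (hasLineDerivAt_sub hU
    (hasLineDerivAt_mul hT (hasLineDerivAt_coord 1 0 j (tDir j))))
    (hasLineDerivAt_mul hXX (hasLineDerivAt_coord 0 1 j (tDir j)))).lineDeriv

theorem Dx_characteristic : Dx (characteristic X) j =
    totalX (compU X) j - (totalX (compT X) j * j.2.2 1 0 + compT X (base j) * j.2.2 1 1)
    - (totalX (compX X) j * j.2.2 0 1 + compX X (base j) * j.2.2 0 2) := by
  have hT := hasLineDerivAt_base_x hΩ (contDiffOn_compT hX) hj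
  have hXX := hasLineDerivAt_base_x hΩ (contDiffOn_compX hX) hj
  have hU := hasLineDerivAt_base_x hΩ (contDiffOn_compU hX) hj
  exact (hasLineDerivAt_sub (hasLineDerivAt_sub hU
    (hasLineDerivAt_mul hT (hasLineDerivAt_coord 1 0 j (xDir j))))
    (hasLineDerivAt_mul hXX (hasLineDerivAt_coord 0 1 j (xDir j)))).lineDeriv

theorem Dx_Dx_characteristic : Dx (Dx (characteristic X)) j =
    totalXX (compU X) j
    - (totalXX (compT X) j * j.2.2 1 0 + 2 * totalX (compT X) j * j.2.2 1 1
      + compT X (base j) * j.2.2 1 2)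
    - (totalXX (compX X) j * j.2.2 0 1 + 2 * totalX (compX X) j * j.2.2 0 2
      + compX X (base j) * j.2.2 0 3) := by
  have hT := hasLineDerivAt_base_x hΩ (contDiffOn_compT hX) hj
  have hXX := hasLineDerivAt_base_x hΩ (contDiffOn_compX hX) hj
  have hT1 := hasLineDerivAt_totalX hΩ (contDiffOn_compT hX) hj
  have hXX1 := hasLineDerivAt_totalX hΩ (contDiffOn_compX hX) hj
  have hU1 := hasLineDerivAt_totalX hΩ (contDiffOn_compU hX) hj
  have hc (i k : ℕ) := hasLineDerivAt_coord i k j (xDir j)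
  refine (lineDeriv_congr hΩ (fun j hj => Dx_characteristic hΩ hX hj) hj _).trans ?_
  refine (hasLineDerivAt_sub (hasLineDerivAt_sub hU1
    (hasLineDerivAt_add (hasLineDerivAt_mul hT1 (hc 1 0)) (hasLineDerivAt_mul hT (hc 1 1))))
    (hasLineDerivAt_add (hasLineDerivAt_mul hXX1 (hc 0 1))
      (hasLineDerivAt_mul hXX (hc 0 2)))).lineDeriv.trans ?_
  ring

theorem Dx_Dx_Dx_characteristic : Dx (Dx (Dx (characteristic X))) j =
    totalXXX (compU X) j
    - (totalXXX (compT X) j * j.2.2 1 0 + 3 * totalXX (compT X) j * j.2.2 1 1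
      + 3 * totalX (compT X) j * j.2.2 1 2 + compT X (base j) * j.2.2 1 3)
    - (totalXXX (compX X) j * j.2.2 0 1 + 3 * totalXX (compX X) j * j.2.2 0 2
      + 3 * totalX (compX X) j * j.2.2 0 3 + compX X (base j) * j.2.2 0 4) := by
  have hT := hasLineDerivAt_base_x hΩ (contDiffOn_compT hX) hj
  have hXX := hasLineDerivAt_base_x hΩ (contDiffOn_compX hX) hj
  have hT1 := hasLineDerivAt_totalX hΩ (contDiffOn_compT hX) hj
  have hXX1 := hasLineDerivAt_totalX hΩ (contDiffOn_compX hX) hj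
  have hT2 := hasLineDerivAt_totalXX hΩ (contDiffOn_compT hX) hj
  have hXX2 := hasLineDerivAt_totalXX hΩ (contDiffOn_compX hX) hj
  have hU2 := hasLineDerivAt_totalXX hΩ (contDiffOn_compU hX) hj
  have hc (i k : ℕ) := hasLineDerivAt_coord i k j (xDir j)
  have h2 := hasLineDerivAt_const 2 j (xDir j)
  refine (lineDeriv_congr hΩ (fun j hj => Dx_Dx_characteristic hΩ hX hj) hj _).trans ?_
  refine (hasLineDerivAt_sub (hasLineDerivAt_sub hU2
    (hasLineDerivAt_add (hasLineDerivAt_add (hasLineDerivAt_mul hT2 (hc 1 0))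
      (hasLineDerivAt_mul (hasLineDerivAt_mul h2 hT1) (hc 1 1))) (hasLineDerivAt_mul hT (hc 1 2))))
    (hasLineDerivAt_add (hasLineDerivAt_add (hasLineDerivAt_mul hXX2 (hc 0 1))
      (hasLineDerivAt_mul (hasLineDerivAt_mul h2 hXX1) (hc 0 2)))
      (hasLineDerivAt_mul hXX (hc 0 3)))).lineDeriv.trans ?_
  ring

end

/-! ### The equation in coordinates and its linearization. -/

theorem isOpen_uRange {Ω : Set Pt} (hΩ : IsOpen Ω) : IsOpen (uRange Ω) :=
  (isOpenMap_snd.comp isOpenMap_snd) Ω hΩ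

section
variable {Ω : Set Pt} (hΩ : IsOpen Ω) {f : ℝ → ℝ} (hf : ContDiffOn ℝ ∞ f (uRange Ω))
  {j : Jet} (hj : base j ∈ Ω)
include hΩ hf

theorem contDiffOn_deriv : ContDiffOn ℝ ∞ (deriv f) (uRange Ω) :=
  hf.deriv_of_isOpen (isOpen_uRange hΩ) (by simp)

include hj

theorem kdv_eq : kdv f j = j.2.2 1 0 + (j.2.2 0 1 ^ 3 + 4 * j.2.2 0 0 * j.2.2 0 1 * j.2.2 0 2
    + j.2.2 0 0 ^ 2 * j.2.2 0 3 + deriv f (j.2.2 0 0) * j.2.2 0 1) := by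
  have hc (i k : ℕ) (j : Jet) := hasLineDerivAt_coord i k j (xDir j)
  have h1 : Dx uCoord = fun j => j.2.2 0 1 := by
    ext j; exact (hc 0 0 j).lineDeriv
  have h2 : Dx (uCoord * fun j => j.2.2 0 1) =
      fun j => j.2.2 0 1 * j.2.2 0 1 + j.2.2 0 0 * j.2.2 0 2 := by
    ext j; exact (hasLineDerivAt_mul (hc 0 0 j) (hc 0 1 j)).lineDeriv
  have h3 : Dt uCoord j = j.2.2 1 0 := (hasLineDerivAt_coord 0 0 j (tDir j)).lineDeriv
  have hf' := hasLineDerivAt_comp_u (ContDiffOn.differentiableAt_of_isOpen (isOpen_uRange hΩ) hf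
    ⟨_, hj, rfl⟩) (xDir j)
  have h4 := (hasLineDerivAt_add (hasLineDerivAt_mul (hc 0 0 j) (hasLineDerivAt_add
    (hasLineDerivAt_mul (hc 0 1 j) (hc 0 1 j)) (hasLineDerivAt_mul (hc 0 0 j) (hc 0 2 j))))
    hf').lineDeriv
  rw [kdv, Pi.add_apply, h1, h2, h3]
  congr 1
  refine Eq.trans h4 ?_
  simp only [zero_add, Nat.reduceAdd]; ring

theorem lineDeriv_kdv (v : Jet) : lineDeriv ℝ (kdv f) j v =
    v.2.2 1 0 + (3 * j.2.2 0 1 ^ 2 * v.2.2 0 1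
      + 4 * (v.2.2 0 0 * j.2.2 0 1 * j.2.2 0 2 + j.2.2 0 0 * v.2.2 0 1 * j.2.2 0 2
        + j.2.2 0 0 * j.2.2 0 1 * v.2.2 0 2)
      + 2 * j.2.2 0 0 * v.2.2 0 0 * j.2.2 0 3 + j.2.2 0 0 ^ 2 * v.2.2 0 3
      + deriv (deriv f) (j.2.2 0 0) * v.2.2 0 0 * j.2.2 0 1
      + deriv f (j.2.2 0 0) * v.2.2 0 1) := by
  have hc (i k : ℕ) := hasLineDerivAt_coord i k j v
  have hf' := hasLineDerivAt_comp_u (ContDiffOn.differentiableAt_of_isOpen (isOpen_uRange hΩ)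
    (contDiffOn_deriv hΩ hf) ⟨_, hj, rfl⟩) v
  have h4 := hasLineDerivAt_const 4 j v
  have e : ∀ j, base j ∈ Ω → kdv f j =
      j.2.2 1 0 + (j.2.2 0 1 * (j.2.2 0 1 * j.2.2 0 1) + 4 * j.2.2 0 0 * j.2.2 0 1 * j.2.2 0 2
    + j.2.2 0 0 * j.2.2 0 0 * j.2.2 0 3 + deriv f (j.2.2 0 0) * j.2.2 0 1) := fun j hj => by
    rw [kdv_eq hΩ hf hj]; ring
  refine (lineDeriv_congr hΩ e hj v).trans ?_
  refine (hasLineDerivAt_add (hc 1 0) (hasLineDerivAt_add (hasLineDerivAt_add (hasLineDerivAt_add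
    (hasLineDerivAt_mul (hc 0 1) (hasLineDerivAt_mul (hc 0 1) (hc 0 1)))
    (hasLineDerivAt_mul (hasLineDerivAt_mul (hasLineDerivAt_mul h4 (hc 0 0)) (hc 0 1)) (hc 0 2)))
    (hasLineDerivAt_mul (hasLineDerivAt_mul (hc 0 0) (hc 0 0)) (hc 0 3)))
    (hasLineDerivAt_mul hf' (hc 0 1)))).lineDeriv.trans ?_
  ring

end

/-! ### The determining condition. -/

/-- The determining condition: the derivative of the equation along the prolongation of a vector
field, at the jet over `p` with `u_x = q`, `u_xx = r`, `u_xxx = s`, `u_tx = y`, `u_txx = z`, in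
terms of the partial derivatives of the field; `P` stands for `u_t`. -/
noncomputable def determining (f : ℝ → ℝ) (X : Pt → Pt) (p : Pt) (P q r s y z : ℝ) : ℝ :=
  let u := p.2.2
  let T := compT X
  let S := compX X
  let N := compU X
  let D1 := fun A : Pt → ℝ => dirD eX A p + dirD eU A p * q
  let D2 := fun A : Pt → ℝ => dirD eX (dirD eX A) p + 2 * dirD eX (dirD eU A) p * q
    + dirD eU (dirD eU A) p * q ^ 2 + dirD eU A p * r
  let D3 := fun A : Pt → ℝ =>
    dirD eX (dirD eX (dirD eX A)) p + 3 * dirD eX (dirD eX (dirD eU A)) p * q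
    + 3 * dirD eX (dirD eU (dirD eU A)) p * q ^ 2
    + dirD eU (dirD eU (dirD eU A)) p * q ^ 3
    + 3 * (dirD eX (dirD eU A) p + dirD eU (dirD eU A) p * q) * r
    + dirD eU A p * s
  let v1 := D1 N - P * D1 T - q * D1 S
  let v2 := D2 N - P * D2 T - 2 * y * D1 T - q * D2 S - 2 * r * D1 S
  let v3 := D3 N - P * D3 T - 3 * y * D2 T - 3 * z * D1 T - q * D3 S - 3 * r * D2 S - 3 * s * D1 S
  (dirD eT N p + dirD eU N p * P - P * (dirD eT T p + dirD eU T p * P)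
    - q * (dirD eT S p + dirD eU S p * P))
  + (3 * q ^ 2 * v1 + 4 * (N p * q * r + u * v1 * r + u * q * v2) + 2 * u * N p * s
    + u ^ 2 * v3 + deriv (deriv f) u * N p * q + deriv f u * v1)

section
variable {Ω : Set Pt} (hΩ : IsOpen Ω) {f : ℝ → ℝ} (hf : ContDiffOn ℝ ∞ f (uRange Ω)) {X : Pt → Pt}
include hΩ hf

/-- The terms `τ u_{i+1,k} + ξ u_{i,k+1}` of the prolongation cancel the undifferentiated `τ` and
`ξ` in the derivatives of the characteristic. So `u_tt`, `u_txxx` and `u_xxxx` drop out. -/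
theorem lineDeriv_kdv_prolongation (hX : ContDiffOn ℝ ∞ X Ω) {j : Jet} (hj : base j ∈ Ω) :
    lineDeriv ℝ (kdv f) j (prolongation X j) = determining f X (base j) (j.2.2 1 0) (j.2.2 0 1)
      (j.2.2 0 2) (j.2.2 0 3) (j.2.2 1 1) (j.2.2 1 2) := by
  rw [lineDeriv_kdv hΩ hf hj]
  have h00 : (prolongation X j).2.2 0 0 = compU X (base j) := by
    simp only [prolongation, Function.iterate_zero, id, characteristic, compU]; ring
  have h10 := Dt_characteristic hΩ hX hj
  have h01 := Dx_characteristic hΩ hX hj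
  have h02 := Dx_Dx_characteristic hΩ hX hj
  have h03 := Dx_Dx_Dx_characteristic hΩ hX hj
  have e10 : (prolongation X j).2.2 1 0 = Dt (characteristic X) j + compT X (base j) * j.2.2 2 0
    + compX X (base j) * j.2.2 1 1 := rfl
  have e01 : (prolongation X j).2.2 0 1 = Dx (characteristic X) j + compT X (base j) * j.2.2 1 1
    + compX X (base j) * j.2.2 0 2 := rfl
  have e02 : (prolongation X j).2.2 0 2 = Dx (Dx (characteristic X)) j
    + compT X (base j) * j.2.2 1 2 + compX X (base j) * j.2.2 0 3 := rfl
  have e03 : (prolongation X j).2.2 0 3 = Dx (Dx (Dx (characteristic X))) j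
    + compT X (base j) * j.2.2 1 3 + compX X (base j) * j.2.2 0 4 := rfl
  have hu : (base j).2.2 = j.2.2 0 0 := rfl
  rw [e10, e01, e02, e03, h00, h10, h01, h02, h03]
  simp only [determining, totalX, totalXX, totalXXX, hu]
  ring

/-- Only the equation itself is imposed on a jet, not its differential consequences, and it can be
solved for `u_t`. Every choice of the other five coordinates is thus realized by an admissible jet.
-/
theorem isPointSymmetry_iff_determining : IsPointSymmetry f Ω X ↔ ContDiffOn ℝ ∞ X Ω ∧
    ∀ p ∈ Ω, ∀ q r s y z : ℝ,
      determining f X p (-(q ^ 3 + 4 * p.2.2 * q * r + p.2.2 ^ 2 * s + deriv f p.2.2 * q))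
        q r s y z = 0 := by
  refine and_congr_right fun hX => ⟨fun h p hp q r s y z => ?_, fun h j hj hk => ?_⟩
  · let P := -(q ^ 3 + 4 * p.2.2 * q * r + p.2.2 ^ 2 * s + deriv f p.2.2 * q)
    let w : ℕ → ℕ → ℝ := fun i k => match i, k with
      | 0, 0 => p.2.2
      | 0, 1 => q
      | 0, 2 => r
      | 0, 3 => s
      | 1, 0 => P
      | 1, 1 => y
      | 1, 2 => z
      | _, _ => 0
    have hj : base (p.1, p.2.1, w) ∈ Ω := hp
    have := h _ hj (by rw [kdv_eq hΩ hf hj]; simp only [w, P]; ring)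
    rwa [lineDeriv_kdv_prolongation hΩ hf hX hj] at this
  · rw [lineDeriv_kdv_prolongation hΩ hf hX hj]
    rw [kdv_eq hΩ hf hj] at hk
    have := h _ hj (j.2.2 0 1) (j.2.2 0 2) (j.2.2 0 3) (j.2.2 1 1) (j.2.2 1 2)
    rw [eq_neg_of_add_eq_zero_left hk]
    exact this

end

/-! ### Differentiation rules and affine functions on `Ω`. -/

theorem dirD_affine (v : Pt) (a b c d : ℝ) :
    dirD v (fun p => a * p.1 + b * p.2.1 + c * p.2.2 + d) =
      fun _ => a * v.1 + b * v.2.1 + c * v.2.2 := by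
  ext p
  let L : Pt →L[ℝ] ℝ := a • ContinuousLinearMap.fst ℝ ℝ (ℝ × ℝ)
    + b • (ContinuousLinearMap.fst ℝ ℝ ℝ).comp (ContinuousLinearMap.snd ℝ ℝ (ℝ × ℝ))
    + c • (ContinuousLinearMap.snd ℝ ℝ ℝ).comp (ContinuousLinearMap.snd ℝ ℝ (ℝ × ℝ))
  have h : HasFDerivAt (fun p : Pt => a * p.1 + b * p.2.1 + c * p.2.2 + d) L p :=
    (L.hasFDerivAt (x := p)).add_const d
  rw [dirD, h.fderiv]; rfl

section
variable {Ω : Set Pt} (hΩ : IsOpen Ω)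
include hΩ

theorem dirD_eq_zero_of_const {A : Pt → ℝ} {c : ℝ} (h : ∀ p ∈ Ω, A p = c) (v : Pt) :
    ∀ p ∈ Ω, dirD v A p = 0 := fun p hp => by
  rw [dirD_congr hΩ (B := fun _ => c) h v hp]
  simp [dirD]

theorem higher_dirD_eq_zero {A : Pt → ℝ} {b c : ℝ} (hX : ∀ p ∈ Ω, dirD eX A p = b)
    (hU : ∀ p ∈ Ω, dirD eU A p = c) {p : Pt} (hp : p ∈ Ω) :
    dirD eX (dirD eX A) p = 0 ∧ dirD eX (dirD eU A) p = 0 ∧ dirD eU (dirD eU A) p = 0 ∧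
    dirD eX (dirD eX (dirD eX A)) p = 0 ∧ dirD eX (dirD eX (dirD eU A)) p = 0 ∧
    dirD eX (dirD eU (dirD eU A)) p = 0 ∧ dirD eU (dirD eU (dirD eU A)) p = 0 := by
  have z {A : Pt → ℝ} {c : ℝ} (h : ∀ p ∈ Ω, A p = c) (v : Pt) := dirD_eq_zero_of_const hΩ h v
  exact ⟨z hX _ _ hp, z hU _ _ hp, z hU _ _ hp, z (z hX _) _ _ hp, z (z hU _) _ _ hp,
    z (z hU _) _ _ hp, z (z hU _) _ _ hp⟩

theorem dirD_of_eq_affine {A : Pt → ℝ} {a b c d : ℝ}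
    (h : ∀ p ∈ Ω, A p = a * p.1 + b * p.2.1 + c * p.2.2 + d) (v : Pt) :
    ∀ p ∈ Ω, dirD v A p = a * v.1 + b * v.2.1 + c * v.2.2 := fun p hp => by
  rw [dirD_congr hΩ h v hp, dirD_affine]

theorem dirD_add_mul {A B : Pt → ℝ} (hA : ContDiffOn ℝ ∞ A Ω) (hB : ContDiffOn ℝ ∞ B Ω)
    (a b : ℝ) (v : Pt) : ∀ p ∈ Ω,
      dirD v (fun p => a * A p + b * B p) p = a * dirD v A p + b * dirD v B p := fun p hp => by
  have hA := ContDiffOn.differentiableAt_of_isOpen hΩ hA hp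
  have hB := ContDiffOn.differentiableAt_of_isOpen hΩ hB hp
  have := ((hA.hasFDerivAt.const_mul a).add (hB.hasFDerivAt.const_mul b)).fderiv
  unfold dirD
  erw [this]
  simp

theorem dirD_mul_comp_u {A : Pt → ℝ} (hA : ContDiffOn ℝ ∞ A Ω) {g : ℝ → ℝ}
    (hg : ∀ u ∈ uRange Ω, DifferentiableAt ℝ g u) (v : Pt) : ∀ p ∈ Ω,
      dirD v (fun p => A p * g p.2.2) p
        = dirD v A p * g p.2.2 + A p * (deriv g p.2.2 * v.2.2) := fun p hp => by
  have hA := (ContDiffOn.differentiableAt_of_isOpen hΩ hA hp).hasFDerivAt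
  have hu : HasFDerivAt (fun p : Pt => p.2.2)
      ((ContinuousLinearMap.snd ℝ ℝ ℝ).comp (ContinuousLinearMap.snd ℝ ℝ (ℝ × ℝ))) p :=
    ((ContinuousLinearMap.snd ℝ ℝ ℝ).comp (ContinuousLinearMap.snd ℝ ℝ (ℝ × ℝ))).hasFDerivAt
  have hg := (hg _ ⟨p, hp, rfl⟩).hasDerivAt.comp_hasFDerivAt p hu
  have := (hA.mul hg).fderiv
  unfold dirD
  erw [this]
  simp
  ring

/-- Moving in the direction of `u` leaves the hyperplane `u = 0` at once, so continuity fills it in.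
The leading coefficients of the equation degenerate there, and this permits division by `u`. -/
theorem eq_zero_of_eq_zero_of_u_ne_zero {A : Pt → ℝ} (hA : ContDiffOn ℝ ∞ A Ω)
    (h : ∀ p ∈ Ω, p.2.2 ≠ 0 → A p = 0) : ∀ p ∈ Ω, A p = 0 := fun p hp => by
  by_cases hu : p.2.2 = 0
  swap
  · exact h p hp hu
  have hc : Continuous fun t : ℝ => p + t • eU := by fun_prop
  have hA : ContinuousAt (fun t : ℝ => A (p + t • eU)) 0 := by
    refine ContinuousAt.comp (g := A) ?_ hc.continuousAt
    exact (ContDiffOn.differentiableAt_of_isOpen hΩ hA (by simpa using hp)).continuousAt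
  have hm := hc.continuousAt.preimage_mem_nhds (x := 0) (hΩ.mem_nhds (by simpa using hp))
  have h1 : Filter.Tendsto (fun t : ℝ => A (p + t • eU)) (nhdsWithin 0 {0}ᶜ) (nhds 0) := by
    refine tendsto_const_nhds.congr' ?_
    filter_upwards [mem_nhdsWithin_of_mem_nhds hm, self_mem_nhdsWithin] with t ht ht0
    exact (h _ ht (by simpa [hu] using ht0)).symm
  have h2 := tendsto_nhds_unique (hA.tendsto.mono_left nhdsWithin_le_nhds) h1
  simpa using h2

theorem exists_eq_affine {A : Pt → ℝ} (hA : ContDiffOn ℝ ∞ A Ω)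
    (hconn : IsConnected Ω) {a b c : ℝ} (hT : ∀ p ∈ Ω, dirD eT A p = a)
    (hX : ∀ p ∈ Ω, dirD eX A p = b) (hU : ∀ p ∈ Ω, dirD eU A p = c) :
    ∃ d, ∀ p ∈ Ω, A p = a * p.1 + b * p.2.1 + c * p.2.2 + d := by
  have hd : ∀ p ∈ Ω, DifferentiableAt ℝ A p := fun p hp =>
    ContDiffOn.differentiableAt_of_isOpen hΩ hA hp
  let B : Pt → ℝ := fun p => a * p.1 + b * p.2.1 + c * p.2.2 + 0
  have hB : Differentiable ℝ B := by unfold B; fun_prop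
  have hBv (p v : Pt) : fderiv ℝ B p v = a * v.1 + b * v.2.1 + c * v.2.2 :=
    congrFun (dirD_affine v a b c 0) p
  obtain ⟨d, hd⟩ := hΩ.exists_is_const_of_fderiv_eq_zero (𝕜 := ℝ) (f := fun p => A p - B p)
    hconn.isPreconnected
    (fun p hp => ((hd p hp).sub (hB p)).differentiableWithinAt) (fun p hp => by
      rw [fderiv_fun_sub (hd p hp) (hB p)]
      refine ContinuousLinearMap.ext fun v => ?_
      have := dirD_add_smul A p v.1 v.2.1 v.2.2
      rw [hT p hp, hX p hp, hU p hp] at this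
      simp only [sub_apply, hBv, Pi.zero_apply, zero_apply]
      linarith)
  refine ⟨d, fun p hp => ?_⟩
  have := hd p hp
  simp only [B] at this; linarith

end

/-! ### Solving the determining equations. -/

/-- On `Ω`, the field `X` is `((3b - 2a) t + c) ∂_t + (b x + k t + d) ∂_x + a u ∂_u`. -/
def IsAffineOn (Ω : Set Pt) (X : Pt → Pt) (a b k c d : ℝ) : Prop :=
  ∀ p ∈ Ω, X p = ((3 * b - 2 * a) * p.1 + c, b * p.2.1 + k * p.1 + d, a * p.2.2)

section
variable {Ω : Set Pt} (hΩ : IsOpen Ω) {f : ℝ → ℝ} (hf : ContDiffOn ℝ ∞ f (uRange Ω)) {X : Pt → Pt}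
include hΩ hf

theorem IsAffineOn.isPointSymmetry {a b k c d : ℝ} (h : IsAffineOn Ω X a b k c d)
    (hk : ∀ u ∈ uRange Ω, 2 * (b - a) * deriv f u + a * (u * deriv (deriv f) u) = k) :
    IsPointSymmetry f Ω X := by
  rw [isPointSymmetry_iff_determining hΩ hf]
  refine ⟨ContDiffOn.congr (ContDiff.contDiffOn (by fun_prop)) h, fun p hp q r s y z => ?_⟩
  have hT : ∀ p ∈ Ω, compT X p = (3 * b - 2 * a) * p.1 + 0 * p.2.1 + 0 * p.2.2 + c :=
    fun p hp => by simp [compT, h p hp]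
  have hS : ∀ p ∈ Ω, compX X p = k * p.1 + b * p.2.1 + 0 * p.2.2 + d :=
    fun p hp => by simp [compX, h p hp]; ring
  have hN : ∀ p ∈ Ω, compU X p = 0 * p.1 + 0 * p.2.1 + a * p.2.2 + 0 :=
    fun p hp => by simp [compU, h p hp]
  have dT := dirD_of_eq_affine hΩ hT
  have dS := dirD_of_eq_affine hΩ hS
  have dN := dirD_of_eq_affine hΩ hN
  obtain ⟨t1, t2, t3, t4, t5, t6, t7⟩ := higher_dirD_eq_zero hΩ (dT eX) (dT eU) hp
  obtain ⟨s1, s2, s3, s4, s5, s6, s7⟩ := higher_dirD_eq_zero hΩ (dS eX) (dS eU) hp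
  obtain ⟨n1, n2, n3, n4, n5, n6, n7⟩ := higher_dirD_eq_zero hΩ (dN eX) (dN eU) hp
  have K := hk _ ⟨p, hp, rfl⟩
  simp only [determining, t1, t2, t3, t4, t5, t6, t7, s1, s2, s3, s4, s5, s6, s7,
    n1, n2, n3, n4, n5, n6, n7, dT _ p hp, dS _ p hp, dN _ p hp, hN p hp]
  linear_combination q * K

-- Differences of values of the determining polynomial at small integer arguments serve to extract
-- its coefficients.
theorem IsPointSymmetry.exists_isAffineOn (hconn : IsConnected Ω) (h : IsPointSymmetry f Ω X) :
    ∃ a b k c d, IsAffineOn Ω X a b k c d ∧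
      ∀ u ∈ uRange Ω, 2 * (b - a) * deriv f u + a * (u * deriv (deriv f) u) = k := by
  rw [isPointSymmetry_iff_determining hΩ hf] at h
  obtain ⟨hX, hE⟩ := h
  have cT := contDiffOn_compT hX
  have cS := contDiffOn_compX hX
  have cN := contDiffOn_compU hX
  have sm {A : Pt → ℝ} (hA : ContDiffOn ℝ ∞ A Ω) (v : Pt) := ContDiffOn.dirD hΩ hA v
  have ext {A : Pt → ℝ} (hA : ContDiffOn ℝ ∞ A Ω) (h : ∀ p ∈ Ω, p.2.2 * (p.2.2 * A p) = 0) :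
      ∀ p ∈ Ω, A p = 0 := eq_zero_of_eq_zero_of_u_ne_zero hΩ hA fun p hp hu => by
    simpa [hu] using h p hp
  have zero {A : Pt → ℝ} (h : ∀ p ∈ Ω, A p = 0) (v : Pt) := dirD_eq_zero_of_const hΩ h v
  -- the coefficient of `u_txx`
  have hTX : ∀ p ∈ Ω, dirD eX (compT X) p = 0 := ext (sm cT eX) fun p hp => by
    have h1 := hE p hp 0 0 0 0 1
    have h0 := hE p hp 0 0 0 0 0
    simp only [determining] at h0 h1
    linear_combination (h0 - h1) / 3
  have hTU : ∀ p ∈ Ω, dirD eU (compT X) p = 0 := ext (sm cT eU) fun p hp => by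
    have h1 := hE p hp 1 0 0 0 1
    have h0 := hE p hp 1 0 0 0 0
    have h2 := hTX p hp
    simp only [determining] at h0 h1
    linear_combination (h0 - h1) / 3 - p.2.2 ^ 2 * h2
  have hTh {p : Pt} (hp : p ∈ Ω) := higher_dirD_eq_zero hΩ hTX hTU hp
  -- Once `τ` depends on `t` alone, `u_tx` and `u_txx` no longer occur.
  have E : ∀ p ∈ Ω, ∀ q r s : ℝ,
      (dirD eT (compU X) p - (dirD eU (compU X) p - dirD eT (compT X) p
        - q * dirD eU (compX X) p) *
          (q ^ 3 + 4 * p.2.2 * q * r + p.2.2 ^ 2 * s + deriv f p.2.2 * q)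
        - q * dirD eT (compX X) p) +
      ((3 * q ^ 2 + 4 * p.2.2 * r + deriv f p.2.2) *
        (dirD eX (compU X) p + dirD eU (compU X) p * q
          - q * (dirD eX (compX X) p + dirD eU (compX X) p * q))
      + compU X p * (4 * q * r + 2 * p.2.2 * s + deriv (deriv f) p.2.2 * q)
      + 4 * p.2.2 * q * (
        dirD eX (dirD eX (compU X)) p + 2 * dirD eX (dirD eU (compU X)) p * q
          + dirD eU (dirD eU (compU X)) p * q ^ 2 + dirD eU (compU X) p * r
        - q * (dirD eX (dirD eX (compX X)) p + 2 * dirD eX (dirD eU (compX X)) p * q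
          + dirD eU (dirD eU (compX X)) p * q ^ 2 + dirD eU (compX X) p * r)
        - 2 * r * (dirD eX (compX X) p + dirD eU (compX X) p * q))
      + p.2.2 ^ 2 * (
        dirD eX (dirD eX (dirD eX (compU X))) p
          + 3 * dirD eX (dirD eX (dirD eU (compU X))) p * q
          + 3 * dirD eX (dirD eU (dirD eU (compU X))) p * q ^ 2
          + dirD eU (dirD eU (dirD eU (compU X))) p * q ^ 3
          + 3 * (dirD eX (dirD eU (compU X)) p + dirD eU (dirD eU (compU X)) p * q) * r
          + dirD eU (compU X) p * s
        - q * (dirD eX (dirD eX (dirD eX (compX X))) p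
          + 3 * dirD eX (dirD eX (dirD eU (compX X))) p * q
          + 3 * dirD eX (dirD eU (dirD eU (compX X))) p * q ^ 2
          + dirD eU (dirD eU (dirD eU (compX X))) p * q ^ 3
          + 3 * (dirD eX (dirD eU (compX X)) p + dirD eU (dirD eU (compX X)) p * q) * r
          + dirD eU (compX X) p * s)
        - 3 * r * (dirD eX (dirD eX (compX X)) p + 2 * dirD eX (dirD eU (compX X)) p * q
          + dirD eU (dirD eU (compX X)) p * q ^ 2 + dirD eU (compX X) p * r)
        - 3 * s * (dirD eX (compX X) p + dirD eU (compX X) p * q))) = 0 := by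
    intro p hp q r s
    obtain ⟨t1, t2, t3, t4, t5, t6, t7⟩ := hTh hp
    have := hE p hp q r s 0 0
    simp only [determining, t1, t2, t3, t4, t5, t6, t7, hTX p hp, hTU p hp] at this
    linear_combination this
  clear hE
  -- the coefficient of `u_xxx`
  have hSU : ∀ p ∈ Ω, dirD eU (compX X) p = 0 := ext (sm cS eU) fun p hp => by
    have h1 := E p hp 1 0 1
    have h2 := E p hp 1 0 0
    have h3 := E p hp 0 0 1
    have h4 := E p hp 0 0 0
    -- The mixed difference isolates the coefficient `-3 u² ξ_u` of `u_x u_xxx`.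
    linear_combination (h2 - h1 + h3 - h4) / 3
  -- The coefficient of `u_xxx` at `u_x = 0` is `u (2η - u (3ξ_x - τ_t))`, so this is `η / u`,
  -- written without division to be smooth across `u = 0`.
  let a : Pt → ℝ := fun p => 3 / 2 * dirD eX (compX X) p + (-1 / 2) * dirD eT (compT X) p
  have ca : ContDiffOn ℝ ∞ a Ω :=
    (contDiffOn_const.mul (sm cS eX)).add (contDiffOn_const.mul (sm cT eT))
  have da := dirD_add_mul hΩ (sm cS eX) (sm cT eT) (3 / 2) (-1 / 2)
  have hN : ∀ p ∈ Ω, compU X p = a p * p.2.2 := by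
    have cu : ContDiffOn ℝ ∞ (fun p : Pt => p.2.2) Ω := by fun_prop
    have := eq_zero_of_eq_zero_of_u_ne_zero hΩ (cN.sub (ca.mul cu)) fun p hp hu => by
      have h3 := E p hp 0 0 1
      have h4 := E p hp 0 0 0
      refine (mul_eq_zero.1 (?_ : p.2.2 * _ = 0)).resolve_left hu
      simp only [a]
      linear_combination (h3 - h4) / 2
    exact fun p hp => sub_eq_zero.1 (this p hp)
  have hSXU : ∀ p ∈ Ω, dirD eU (dirD eX (compX X)) p = 0 := fun p hp => by
    rw [dirD_comm hΩ cS eU eX hp]; exact zero hSU _ p hp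
  have haU : ∀ p ∈ Ω, dirD eU a p = 0 := fun p hp => by
    rw [da eU p hp, hSXU p hp, dirD_comm hΩ cT eU eT hp, zero hTU _ p hp]; ring
  have haX : ∀ p ∈ Ω, dirD eX a p = 3 / 2 * dirD eX (dirD eX (compX X)) p := fun p hp => by
    rw [da eX p hp, dirD_comm hΩ cT eX eT hp, zero hTX _ p hp]; ring
  have hNd (v : Pt) : ∀ p ∈ Ω, dirD v (compU X) p = dirD v a p * p.2.2 + a p * v.2.2 :=
    fun p hp => by
      rw [dirD_congr hΩ hN v hp,
        dirD_mul_comp_u hΩ ca (g := fun u => u) (fun u _ => differentiableAt_id) v p hp]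
      simp
  have hNU : ∀ p ∈ Ω, dirD eU (compU X) p = a p := fun p hp => by
    rw [hNd eU p hp, haU p hp]; ring
  have hNX : ∀ p ∈ Ω, dirD eX (compU X) p = dirD eX a p * p.2.2 := fun p hp => by
    rw [hNd eX p hp]; ring
  have hNT : ∀ p ∈ Ω, dirD eT (compU X) p = dirD eT a p * p.2.2 := fun p hp => by
    rw [hNd eT p hp]; ring
  -- the coefficient of `u_xx`
  have hSXX : ∀ p ∈ Ω, dirD eX (dirD eX (compX X)) p = 0 := ext (sm (sm cS eX) eX) fun p hp => by
    have h3 := E p hp 0 1 0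
    have h4 := E p hp 0 0 0
    have h5 := dirD_congr hΩ hNU eX hp
    have h6 := zero hSU eX p hp
    rw [h5, hNX p hp, haX p hp, hSU p hp] at h3
    rw [hNX p hp, haX p hp] at h4
    -- With `η = a u` and `a_x = (3/2) ξ_xx` the coefficient is `(4 + 3) u² a_x - 3 u² ξ_xx = (15/2)
    -- u² ξ_xx`.
    linear_combination (h3 - h4) * (2 / 15)
  have haX : ∀ p ∈ Ω, dirD eX a p = 0 := fun p hp => by rw [haX p hp, hSXX p hp, mul_zero]
  have hNX : ∀ p ∈ Ω, dirD eX (compU X) p = 0 := fun p hp => by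
    rw [hNX p hp, haX p hp, zero_mul]
  have haT : ∀ p ∈ Ω, dirD eT a p = 0 := ext (sm ca eT) fun p hp => by
    have h4 := E p hp 0 0 0
    rw [hNT p hp, hNX p hp, zero (zero hNX eX) eX p hp] at h4
    linear_combination h4 * p.2.2
  -- This comes from `u_x = 1`, `u_xx = u_xxx = 0`; the contribution of `u_x ^ 3` is `2a + τ_t -
  -- 3ξ_x`, zero by the choice of `a`. The factors `1` fit the shape of `dirD_add_mul`.
  have hST : ∀ p ∈ Ω, dirD eT (compX X) p =
      1 * ((2 * dirD eX (compX X) p + (-2) * a p) * deriv f p.2.2)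
        + 1 * (a p * (p.2.2 * deriv (deriv f) p.2.2)) := fun p hp => by
    have h4 := E p hp 1 0 0
    have z {A : Pt → ℝ} {c : ℝ} (h : ∀ p ∈ Ω, A p = c) (v : Pt) := dirD_eq_zero_of_const hΩ h v
    have n2 : ∀ p ∈ Ω, dirD eX (dirD eU (compU X)) p = 0 := fun p hp => by
      rw [dirD_congr hΩ hNU eX hp, haX p hp]
    have n3 : ∀ p ∈ Ω, dirD eU (dirD eU (compU X)) p = 0 := fun p hp => by
      rw [dirD_congr hΩ hNU eU hp, haU p hp]
    rw [hNT p hp, haT p hp, hNX p hp, hNU p hp, hN p hp, n2 p hp, n3 p hp, zero n2 eX p hp,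
      zero n3 eX p hp, zero n3 eU p hp, zero hNX eX p hp, zero (zero hNX eX) eX p hp, hSU p hp,
      hSXX p hp, zero hSXX eX p hp, zero hSU eX p hp, zero hSU eU p hp,
      zero (zero hSU eX) eX p hp, zero (zero hSU eU) eX p hp, zero (zero hSU eU) eU p hp] at h4
    have ha : a p = 3 / 2 * dirD eX (compX X) p + (-1 / 2) * dirD eT (compT X) p := rfl
    linear_combination -h4 - 2 * (1 + deriv f p.2.2) * ha
  have cf := contDiffOn_deriv hΩ hf
  have dif {g : ℝ → ℝ} (hg : ContDiffOn ℝ ∞ g (uRange Ω)) (u : ℝ) (hu : u ∈ uRange Ω) :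
      DifferentiableAt ℝ g u :=
    ContDiffOn.differentiableAt_of_isOpen (isOpen_uRange hΩ) hg hu
  have cu : ContDiffOn ℝ ∞ (fun p : Pt => p.2.2) Ω := by fun_prop
  have hu : Set.MapsTo (fun p : Pt => p.2.2) Ω (uRange Ω) := fun p hp => ⟨p, hp, rfl⟩
  have cg : ContDiffOn ℝ ∞ (fun u => u * deriv (deriv f) u) (uRange Ω) :=
    contDiffOn_id.mul (contDiffOn_deriv hΩ cf)
  have cb : ContDiffOn ℝ ∞ (fun p => 2 * dirD eX (compX X) p + (-2) * a p) Ω :=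
    (contDiffOn_const.mul (sm cS eX)).add (contDiffOn_const.mul ca)
  have c1 : ContDiffOn ℝ ∞ (fun p => (2 * dirD eX (compX X) p + (-2) * a p) * deriv f p.2.2) Ω :=
    cb.mul (cf.comp cu hu)
  have c2 : ContDiffOn ℝ ∞ (fun p => a p * (p.2.2 * deriv (deriv f) p.2.2)) Ω :=
    ca.mul (cg.comp cu hu)
  -- A direction without `u`-component does not see `f'` and `f''`, so `ξ_t` varies along it only
  -- through `a` and `ξ_x`. Applied to `x` this gives `ξ_tx = 0`, which is the input needed to apply
  -- it to `t`.
  have hSTd (v : Pt) (hv : v.2.2 = 0) (ha : ∀ p ∈ Ω, dirD v a p = 0)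
      (hS : ∀ p ∈ Ω, dirD v (dirD eX (compX X)) p = 0) :
      ∀ p ∈ Ω, dirD v (dirD eT (compX X)) p = 0 := fun p hp => by
    rw [dirD_congr hΩ hST v hp,
      dirD_add_mul hΩ c1 c2 1 1 v p hp, dirD_mul_comp_u hΩ cb (dif cf) v p hp,
      dirD_mul_comp_u hΩ ca (g := fun u => u * deriv (deriv f) u) (dif cg) v p hp,
      dirD_add_mul hΩ (sm cS eX) ca 2 (-2) v p hp, ha p hp, hS p hp, hv]
    ring
  have hSTX := hSTd eX rfl haX hSXX
  have hSXT : ∀ p ∈ Ω, dirD eT (dirD eX (compX X)) p = 0 := fun p hp => by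
    rw [dirD_comm hΩ cS eT eX hp, hSTX p hp]
  have hSTT := hSTd eT rfl haT hSXT
  have hSTU : ∀ p ∈ Ω, dirD eU (dirD eT (compX X)) p = 0 := fun p hp => by
    rw [dirD_comm hΩ cS eU eT hp, zero hSU eT p hp]
  obtain ⟨a₀, ha⟩ := exists_eq_affine hΩ ca hconn haT haX haU
  obtain ⟨b, hb⟩ := exists_eq_affine hΩ (sm cS eX) hconn hSXT hSXX hSXU
  obtain ⟨k, hk⟩ := exists_eq_affine hΩ (sm cS eT) hconn hSTT hSTX hSTU
  simp only [zero_mul, zero_add] at ha hb hk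
  obtain ⟨c, hc⟩ := exists_eq_affine hΩ cT hconn (a := 3 * b - 2 * a₀) (fun p hp => by
    have h1 := ha p hp
    have h2 := hb p hp
    simp only [a] at h1
    linarith) hTX hTU
  obtain ⟨d, hd⟩ := exists_eq_affine hΩ cS hconn hk hb hSU
  refine ⟨a₀, b, k, c, d, fun p hp => Prod.ext ?_ (Prod.ext ?_ ?_), ?_⟩
  · refine (hc p hp).trans ?_; ring
  · refine (hd p hp).trans ?_; ring
  · exact (hN p hp).trans (by rw [ha p hp])
  · rintro _ ⟨p, hp, rfl⟩
    have := hST p hp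
    rw [hk p hp, ha p hp, hb p hp] at this
    linear_combination -this

theorem isPointSymmetry_iff (hconn : IsConnected Ω) : IsPointSymmetry f Ω X ↔
    ∃ a b k c d, IsAffineOn Ω X a b k c d ∧
      ∀ u ∈ uRange Ω, 2 * (b - a) * deriv f u + a * (u * deriv (deriv f) u) = k :=
  ⟨fun h => h.exists_isAffineOn hΩ hf hconn,
    fun ⟨_, _, _, _, _, h, hk⟩ => h.isPointSymmetry hΩ hf hk⟩

end

/-! ### The Euler equation `u h' = m h` on an interval. -/

section
variable {I : Set ℝ} (hI : IsOpen I) (hconn : IsPreconnected I)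
include hI hconn

theorem exists_eq_add_const {f F : ℝ → ℝ} (hf : ContDiffOn ℝ ∞ f I)
    (hF : ∀ u ∈ I, HasDerivAt F (deriv f u) u) : ∃ c, ∀ u ∈ I, f u = F u + c := by
  have hd (u : ℝ) (hu : u ∈ I) : HasDerivAt (fun u => f u - F u) 0 u := by
    simpa using (ContDiffOn.differentiableAt_of_isOpen hI hf hu).hasDerivAt.fun_sub (hF u hu)
  obtain ⟨c, hc⟩ := hI.exists_is_const_of_deriv_eq_zero hconn
    (fun u hu => (hd u hu).differentiableAt.differentiableWithinAt) (fun u hu => (hd u hu).deriv)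
  exact ⟨c, fun u hu => by linarith [hc u hu]⟩

/-- A solution of `u h' = m h` that is regular at `u = 0` vanishes if `m < 0`. -/
theorem eq_zero_of_mul_deriv_eq_neg (h0 : (0 : ℝ) ∈ I) {h : ℝ → ℝ} (hh : ContDiffOn ℝ ∞ h I)
    {m : ℝ} (hm : m < 0) (heq : ∀ u ∈ I, u * deriv h u = m * h u) : ∀ u ∈ I, h u = 0 := by
  intro u hu
  have hmem : ∀ s ∈ Set.Icc (0 : ℝ) 1, s * u ∈ I := fun s hs => by
    have := hconn.ordConnected.convex.starConvex h0 hu (sub_nonneg.2 hs.2) hs.1 (by ring)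
    simpa using this
  -- Along the segment from `0` to `u`, `s` times the derivative of `h(su)²` is `2m h(su)² ≤ 0`. So
  -- `h(su)²` decreases from `h(0)² = 0`.
  have hd : ∀ s ∈ Set.Icc (0 : ℝ) 1, HasDerivAt (fun s => h (s * u) ^ 2)
      (2 * h (s * u) * (deriv h (s * u) * u)) s := fun s hs => by
    have h1 : HasDerivAt (fun s : ℝ => s * u) u s := by
      simpa using (hasDerivAt_id s).mul_const u
    have h2 := (ContDiffOn.differentiableAt_of_isOpen hI hh (hmem s hs)).hasDerivAt.comp s h1
    simpa using h2.fun_pow 2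
  have hanti : AntitoneOn (fun s => h (s * u) ^ 2) (Set.Icc 0 1) := by
    refine antitoneOn_of_deriv_nonpos (convex_Icc 0 1)
      (fun s hs => (hd s hs).continuousAt.continuousWithinAt)
      (fun s hs => (hd s (interior_subset hs)).differentiableAt.differentiableWithinAt) ?_
    intro s hs
    rw [(hd s (interior_subset hs)).deriv]
    rw [interior_Icc] at hs
    have := heq _ (hmem s ⟨hs.1.le, hs.2.le⟩)
    have h3 : s * (2 * h (s * u) * (deriv h (s * u) * u)) ≤ 0 := by
      have : s * (2 * h (s * u) * (deriv h (s * u) * u)) = m * (2 * h (s * u) ^ 2) := by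
        linear_combination 2 * h (s * u) * this
      rw [this]
      exact mul_nonpos_of_nonpos_of_nonneg hm.le (by positivity)
    by_contra hcon
    exact absurd h3 (not_le.2 (mul_pos hs.1 (not_le.1 hcon)))
  have h1 := hanti (Set.left_mem_Icc.2 zero_le_one) (Set.right_mem_Icc.2 zero_le_one) zero_le_one
  have h2 : h 0 = 0 := by simpa [hm.ne] using heq 0 h0
  simp only [zero_mul, one_mul, h2] at h1
  nlinarith

/-- Differentiating `u h' = m h` gives the same equation for `h'` with `m - 1`. After finitely many
steps the exponent is negative and the solution vanishes. -/
theorem exists_eq_rpow_of_zero_mem (h0 : (0 : ℝ) ∈ I) (n : ℕ) : ∀ {h : ℝ → ℝ} {m : ℝ},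
    ContDiffOn ℝ ∞ h I → m < n → (∀ u ∈ I, u * deriv h u = m * h u) →
    ∃ C, (∀ u ∈ I, h u = C * u ^ m) ∧ (C = 0 ∨ ∃ k : ℕ, m = k) := by
  induction n with
  | zero =>
    intro h m hh hm heq
    exact ⟨0, fun u hu => by
      rw [eq_zero_of_mul_deriv_eq_neg hI hconn h0 hh (by simpa using hm) heq u hu, zero_mul],
      Or.inl rfl⟩
  | succ n ih =>
    intro h m hh hm heq
    have hh' : ContDiffOn ℝ ∞ (deriv h) I := hh.deriv_of_isOpen hI (by simp)
    obtain ⟨C, hC, hCm⟩ := ih hh' (m := m - 1) (by push_cast at hm; linarith) (fun u hu => by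
      have h1 : HasDerivAt (fun u => u * deriv h u) (1 * deriv h u + u * deriv (deriv h) u) u :=
        (hasDerivAt_id u).fun_mul (ContDiffOn.differentiableAt_of_isOpen hI hh' hu).hasDerivAt
      have h2 : HasDerivAt (fun u => m * h u) (m * deriv h u) u :=
        (ContDiffOn.differentiableAt_of_isOpen hI hh hu).hasDerivAt.const_mul m
      have h3 := h1.unique (h2.congr_of_eventuallyEq
        (Filter.eventuallyEq_of_mem (hI.mem_nhds hu) heq))
      linear_combination h3)
    by_cases hm0 : m = 0
    · subst hm0
      -- Here `h'` would have the exponent `-1`, which is not a natural number.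
      have hC0 : C = 0 := hCm.resolve_right (by
        rintro ⟨k, hk⟩
        have : (0 : ℝ) ≤ k := k.cast_nonneg
        linarith)
      obtain ⟨c, hc⟩ := exists_eq_add_const hI hconn (F := fun _ => 0) hh (fun u hu => by
        rw [hC u hu, hC0, zero_mul]; exact hasDerivAt_const _ _)
      exact ⟨c, fun u hu => by simp [hc u hu], Or.inr ⟨0, by simp⟩⟩
    · refine ⟨C / m, fun u hu => ?_, ?_⟩
      · have h1 := heq u hu
        rw [hC u hu] at h1
        -- For `C ≠ 0` the exponent is natural, so `u ^ m = u ^ k * u` also for `u ≤ 0`, where real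
        -- powers do not obey this rule in general.
        rcases hCm with rfl | ⟨k, hk⟩
        · simpa [hm0] using h1.symm
        · have hm1 : m = ((k + 1 : ℕ) : ℝ) := by push_cast; linarith
          rw [hk, Real.rpow_natCast] at h1
          have h2 : u ^ m = u ^ k * u := by rw [hm1, Real.rpow_natCast, pow_succ]
          rw [h2]
          field_simp
          linear_combination -h1
      · rcases hCm with rfl | ⟨k, hk⟩
        · left; simp
        · right; exact ⟨k + 1, by push_cast; linarith⟩

omit hI in
theorem pos_of_zero_notMem (hpos : ∃ u ∈ I, 0 < u) (h0 : (0 : ℝ) ∉ I) : ∀ u ∈ I, 0 < u := by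
  intro u hu
  obtain ⟨v, hv, hv0⟩ := hpos
  by_contra hcon
  exact h0 (hconn.ordConnected.out hu hv ⟨not_lt.1 hcon, hv0.le⟩)

/-- The regular solutions of `u h' = m h` on an interval that contains a positive number. -/
theorem exists_eq_rpow (hpos : ∃ u ∈ I, 0 < u) {h : ℝ → ℝ} {m : ℝ} (hh : ContDiffOn ℝ ∞ h I)
    (heq : ∀ u ∈ I, u * deriv h u = m * h u) :
    ∃ C, (∀ u ∈ I, h u = C * u ^ m) ∧ (C = 0 ∨ 0 ≤ m ∨ ∀ u ∈ I, 0 < u) := by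
  by_cases h0 : (0 : ℝ) ∈ I
  · obtain ⟨n, hn⟩ := exists_nat_gt m
    obtain ⟨C, hC, hm⟩ := exists_eq_rpow_of_zero_mem hI hconn h0 n hh hn heq
    refine ⟨C, hC, hm.imp_right fun ⟨k, hk⟩ => Or.inl ?_⟩
    rw [hk]; positivity
  · have hp := pos_of_zero_notMem hconn hpos h0
    -- On a positive interval `u^(-m)` is an integrating factor.
    have hd (u : ℝ) (hu : u ∈ I) : HasDerivAt (fun u => h u * u ^ (-m)) 0 u := by
      have h1 := (ContDiffOn.differentiableAt_of_isOpen hI hh hu).hasDerivAt.fun_mul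
        (Real.hasDerivAt_rpow_const (p := -m) (Or.inl (hp u hu).ne'))
      refine h1.congr_deriv ?_
      rw [Real.rpow_sub_one (hp u hu).ne']
      have := (hp u hu).ne'
      field_simp
      linear_combination u ^ (-m) * heq u hu
    obtain ⟨C, hC⟩ := hI.exists_is_const_of_deriv_eq_zero hconn
      (fun u hu => (hd u hu).differentiableAt.differentiableWithinAt) (fun u hu => (hd u hu).deriv)
    refine ⟨C, fun u hu => ?_, Or.inr (Or.inr hp)⟩
    rw [← hC u hu, mul_assoc, ← Real.rpow_add (hp u hu)]
    simp

end

/-! ### From the relation to the three forms of `f`. -/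

/-- The condition on the equation under which an affine field with coefficients `a`, `b`, `k` is a
symmetry. -/
def StructureRelation (Ω : Set Pt) (f : ℝ → ℝ) (a b k : ℝ) : Prop :=
  ∀ u ∈ uRange Ω, 2 * (b - a) * deriv f u + a * (u * deriv (deriv f) u) = k

section
variable {Ω : Set Pt}

theorem isPreconnected_uRange (hconn : IsConnected Ω) : IsPreconnected (uRange Ω) :=
  hconn.isPreconnected.image _ (by fun_prop)

section
variable (hΩ : IsOpen Ω) (hconn : IsConnected Ω) {f : ℝ → ℝ} (hf : Admissible Ω f)
include hΩ hconn hf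

/-- A linear `f` is the power case with `n = 1`, `f₁ = 0`; the slope is nonzero because `f'` does
not vanish identically. -/
theorem exists_isPower_of_deriv_eq_const {L : ℝ} (hL : ∀ u ∈ uRange Ω, deriv f u = L) :
    ∃ n f₀ f₁ f₂ : ℝ, IsPower Ω f n f₀ f₁ f₂ := by
  obtain ⟨hf, v, hv, hv0⟩ := hf
  obtain ⟨c, hc⟩ := exists_eq_add_const (isOpen_uRange hΩ) (isPreconnected_uRange hconn)
    (F := fun u => L * u) hf (fun u hu => by
      rw [hL u hu]; simpa using (hasDerivAt_id u).const_mul L)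
  refine ⟨1, L, 0, c, one_ne_zero, hL v hv ▸ hv0, fun u hu => ?_⟩
  rw [hc u hu, Real.rpow_one]; ring

/-- For `a ≠ 0` the relation is `u h' = m h + κ` for `h = f'`. Resonance `m = 0 ≠ κ` yields `u ln
u`, the exponent `m = -1` yields `ln u`, any other `m ≠ 0` yields `u^(m+1)`; constant solutions give
linear `f`. -/
theorem exists_form_of_structureRelation (hpos : ∃ u ∈ uRange Ω, 0 < u) {a b k : ℝ}
    (h : StructureRelation Ω f a b k) (hne : ¬(a = 0 ∧ b = 0 ∧ k = 0)) :
    (∃ n f₀ f₁ f₂ : ℝ, IsPower Ω f n f₀ f₁ f₂) ∨ (∃ f₀ f₁ f₂ : ℝ, IsULog Ω f f₀ f₁ f₂) ∨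
      (∃ f₀ f₁ f₂ : ℝ, IsLog Ω f f₀ f₁ f₂) := by
  have hI := isOpen_uRange hΩ
  have hIc := isPreconnected_uRange hconn
  have hf1 := contDiffOn_deriv hΩ hf.1
  have dif {u : ℝ} (hu : u ∈ uRange Ω) :=
    (ContDiffOn.differentiableAt_of_isOpen hI hf1 hu).hasDerivAt
  by_cases ha : a = 0
  · subst ha
    by_cases hb : b = 0
    · subst hb
      obtain ⟨u, hu, -⟩ := hpos
      exact absurd ⟨rfl, rfl, by simpa using (h u hu).symm⟩ hne
    · refine Or.inl (exists_isPower_of_deriv_eq_const hΩ hconn hf (L := k / (2 * b)) fun u hu => ?_)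
      have := h u hu
      field_simp
      linear_combination this
  obtain ⟨m, hm⟩ : ∃ m, a * m = 2 * (a - b) := ⟨2 * (a - b) / a, by field_simp⟩
  obtain ⟨κ, hκ⟩ : ∃ κ, a * κ = k := ⟨k / a, by field_simp⟩
  have heq : ∀ u ∈ uRange Ω, u * deriv (deriv f) u = m * deriv f u + κ := fun u hu => by
    refine mul_left_cancel₀ ha ?_
    linear_combination h u hu - hm * deriv f u - hκ
  by_cases hm0 : m = 0
  · subst hm0
    by_cases hκ0 : κ = 0
    · subst hκ0
      obtain ⟨C, hC, -⟩ := exists_eq_rpow hI hIc hpos (m := 0) hf1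
        (fun u hu => by linear_combination heq u hu)
      exact Or.inl (exists_isPower_of_deriv_eq_const hΩ hconn hf (L := C) fun u hu => by
        simpa using hC u hu)
    -- At `u = 0` the equation would read `0 = κ`.
    · have hp := pos_of_zero_notMem hIc hpos (fun h0 => hκ0 (by simpa using (heq 0 h0).symm))
      obtain ⟨C, hC⟩ := exists_eq_add_const hI hIc (F := fun u => κ * Real.log u) hf1
        (fun u hu => by
          refine ((Real.hasDerivAt_log (hp u hu).ne').const_mul κ).congr_deriv ?_
          have := (hp u hu).ne'
          field_simp
          linear_combination -heq u hu)
      obtain ⟨c, hc⟩ := exists_eq_add_const hI hIc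
        (F := fun u => κ * (u * Real.log u) + (C - κ) * u) hf.1 (fun u hu => by
          refine (((Real.hasDerivAt_mul_log (hp u hu).ne').const_mul κ).add
            ((hasDerivAt_id u).const_mul (C - κ))).congr_deriv ?_
          rw [hC u hu]; ring)
      refine Or.inr (Or.inl ⟨κ, C - κ, c, hκ0, fun u hu => ?_⟩)
      rw [hc u hu]; ring
  -- The shift by `κ / m` makes the equation homogeneous.
  · obtain ⟨C, hC, hCm⟩ := exists_eq_rpow hI hIc hpos (h := fun u => deriv f u + κ / m) (m := m)
      (hf1.add contDiffOn_const) (fun u hu => by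
        rw [deriv_add_const, heq u hu]; field_simp)
    by_cases hC0 : C = 0
    · exact Or.inl (exists_isPower_of_deriv_eq_const hΩ hconn hf (L := -(κ / m)) fun u hu => by
        have := hC u hu
        rw [hC0] at this
        linarith)
    by_cases hm1 : m = -1
    · have hp := (hCm.resolve_left hC0).resolve_left (by rw [hm1]; norm_num)
      obtain ⟨c, hc⟩ := exists_eq_add_const hI hIc
        (F := fun u => C * Real.log u + (-(κ / m)) * u) hf.1 (fun u hu => by
          refine (((Real.hasDerivAt_log (hp u hu).ne').const_mul C).add
            ((hasDerivAt_id u).const_mul (-(κ / m)))).congr_deriv ?_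
          have := hC u hu
          rw [show u ^ m = u⁻¹ by rw [hm1, Real.rpow_neg_one]] at this
          linear_combination -this)
      exact Or.inr (Or.inr ⟨C, -(κ / m), c, hC0, hc⟩)
    · have hm1 : m + 1 ≠ 0 := fun h => hm1 (by linarith)
      obtain ⟨c, hc⟩ := exists_eq_add_const hI hIc
        (F := fun u => C / (m + 1) * u ^ (m + 1) + (-(κ / m)) * u) hf.1 (fun u hu => by
          have hu' : u ≠ 0 ∨ 1 ≤ m + 1 := by
            rcases hCm.resolve_left hC0 with h | h
            · right; linarith
            · left; exact (h u hu).ne'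
          refine (((Real.hasDerivAt_rpow_const hu').const_mul (C / (m + 1))).add
            ((hasDerivAt_id u).const_mul (-(κ / m)))).congr_deriv ?_
          have := hC u hu
          rw [add_sub_cancel_right]
          have e : C / (m + 1) * ((m + 1) * u ^ m) = C * u ^ m := by field_simp
          rw [e]
          linear_combination -this)
      exact Or.inl ⟨m + 1, C / (m + 1), -(κ / m), c, hm1, div_ne_zero hC0 hm1, hc⟩

end

/-! ### Derivatives of the explicit forms away from zero. -/

section
variable (hΩ : IsOpen Ω) {f : ℝ → ℝ} (hf : ContDiffOn ℝ ∞ f (uRange Ω))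
include hΩ hf

/-- Both sides are continuous because `f` is smooth, so `u = 0` is harmless. Explicit powers and
logarithms then need to be differentiated only off zero. -/
theorem structureRelation_of_ne_zero {a b k : ℝ} (h : ∀ u ∈ uRange Ω, u ≠ 0 →
    2 * (b - a) * deriv f u + a * (u * deriv (deriv f) u) = k) : StructureRelation Ω f a b k := by
  have hf1 := contDiffOn_deriv hΩ hf
  have hf2 := contDiffOn_deriv hΩ hf1
  have hu : Set.MapsTo (fun p : Pt => p.2.2) Ω (uRange Ω) := fun p hp => ⟨p, hp, rfl⟩
  have cu : ContDiffOn ℝ ∞ (fun p : Pt => p.2.2) Ω := by fun_prop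
  have hA : ContDiffOn ℝ ∞ (fun p : Pt => 2 * (b - a) * deriv f p.2.2
      + a * (p.2.2 * deriv (deriv f) p.2.2) - k) Ω :=
    ((contDiffOn_const.mul (hf1.comp cu hu)).add
      (contDiffOn_const.mul (cu.mul (hf2.comp cu hu)))).sub contDiffOn_const
  have := eq_zero_of_eq_zero_of_u_ne_zero hΩ hA
    (fun p hp hp0 => sub_eq_zero.2 (h _ ⟨p, hp, rfl⟩ hp0))
  rintro _ ⟨p, hp, rfl⟩
  exact sub_eq_zero.1 (this p hp)

omit hf in
/-- If `f` agrees with `F` on `uRange Ω`, so do its first two derivatives away from zero. -/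
theorem derivs_eq_of_eqOn {F F' F'' : ℝ → ℝ} (h : ∀ u ∈ uRange Ω, f u = F u)
    (hF : ∀ u, u ≠ 0 → HasDerivAt F (F' u) u) (hF' : ∀ u, u ≠ 0 → HasDerivAt F' (F'' u) u)
    {u : ℝ} (hu : u ∈ uRange Ω) (hu0 : u ≠ 0) :
    deriv f u = F' u ∧ deriv (deriv f) u = F'' u := by
  have h1 : ∀ u ∈ uRange Ω, u ≠ 0 → deriv f u = F' u := fun u hu hu0 =>
    ((hF u hu0).congr_of_eventuallyEq
      (Filter.eventuallyEq_of_mem ((isOpen_uRange hΩ).mem_nhds hu) h)).deriv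
  refine ⟨h1 u hu hu0, ((hF' u hu0).congr_of_eventuallyEq ?_).deriv⟩
  filter_upwards [(isOpen_uRange hΩ).mem_nhds hu, isOpen_ne.mem_nhds hu0] with v hv hv0
  exact h1 v hv hv0

end

/-! ### Spans of vector fields on `Ω`. -/

theorem mem_generatedOn_pair {X : Pt → Pt} : X ∈ generatedOn Ω {X₁, X₂} ↔
    ∃ c d : ℝ, ∀ p ∈ Ω, X p = (c, d, 0) := by
  simp only [generatedOn, Set.mem_ofPred_eq, Submodule.mem_span_pair]
  constructor
  · rintro ⟨_, ⟨c, d, rfl⟩, h⟩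
    exact ⟨c, d, fun p hp => by rw [h hp]; simp [X₁, X₂]⟩
  · rintro ⟨c, d, h⟩
    exact ⟨_, ⟨c, d, rfl⟩, fun p hp => by rw [h p hp]; simp [X₁, X₂]⟩

theorem mem_generatedOn_triple {X Y : Pt → Pt} : X ∈ generatedOn Ω {X₁, X₂, Y} ↔
    ∃ c d e : ℝ, ∀ p ∈ Ω, X p = (c, d, 0) + e • Y p := by
  simp only [generatedOn, Set.mem_ofPred_eq, Submodule.mem_span_triple]
  constructor
  · rintro ⟨_, ⟨c, d, e, rfl⟩, h⟩
    exact ⟨c, d, e, fun p hp => by rw [h hp]; simp [X₁, X₂]⟩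
  · rintro ⟨c, d, e, h⟩
    exact ⟨_, ⟨c, d, e, rfl⟩, fun p hp => by rw [h p hp]; simp [X₁, X₂]⟩

theorem mem_generatedOn_quadruple {X Y Z : Pt → Pt} : X ∈ generatedOn Ω {X₁, X₂, Y, Z} ↔
    ∃ c d e g : ℝ, ∀ p ∈ Ω, X p = (c, d, 0) + e • Y p + g • Z p := by
  simp only [generatedOn, Set.mem_ofPred_eq]
  rw [show ({X₁, X₂, Y, Z} : Set (Pt → Pt)) = insert X₁ {X₂, Y, Z} from rfl]
  simp only [Submodule.mem_span_insert (s := {X₂, Y, Z}), Submodule.mem_span_triple]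
  constructor
  · rintro ⟨_, ⟨c, _, ⟨d, e, g, rfl⟩, rfl⟩, h⟩
    exact ⟨c, d, e, g, fun p hp => by rw [h hp]; simp [X₁, X₂, ← add_assoc]⟩
  · rintro ⟨c, d, e, g, h⟩
    exact ⟨_, ⟨c, _, ⟨d, e, g, rfl⟩, rfl⟩, fun p hp => by rw [h p hp]; simp [X₁, X₂, ← add_assoc]⟩

/-- A homogeneous field with coefficients `a₀ ≠ 0`, `b₀`, `k₀` spans the symmetries modulo
translations if the relation on the coefficients has a one-dimensional solution space. -/
theorem generatedOn_of_structureRelation_iff (hΩ : IsOpen Ω) (hconn : IsConnected Ω)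
    (hpos : ∃ p ∈ Ω, 0 < p.2.2) {f : ℝ → ℝ} (hf : ContDiffOn ℝ ∞ f (uRange Ω)) {Y : Pt → Pt}
    {a₀ b₀ k₀ : ℝ} (ha₀ : a₀ ≠ 0)
    (hY : ∀ p, Y p = ((3 * b₀ - 2 * a₀) * p.1, b₀ * p.2.1 + k₀ * p.1, a₀ * p.2.2))
    (hrel : ∀ a b k, StructureRelation Ω f a b k ↔ ∃ e, a = e * a₀ ∧ b = e * b₀ ∧ k = e * k₀) :
    Y ∉ generatedOn Ω {X₁, X₂} ∧
      {X | IsPointSymmetry f Ω X} = generatedOn Ω {X₁, X₂, Y} := by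
  constructor
  · rw [mem_generatedOn_pair]
    rintro ⟨c, d, h⟩
    obtain ⟨p, hp, hu⟩ := hpos
    have := congrArg (fun q : Pt => q.2.2) ((hY p).symm.trans (h p hp))
    simp [ha₀, hu.ne'] at this
  · ext X
    rw [Set.mem_ofPred_eq, isPointSymmetry_iff hΩ hf hconn, mem_generatedOn_triple]
    constructor
    · rintro ⟨a, b, k, c, d, h, hk⟩
      obtain ⟨e, rfl, rfl, rfl⟩ := (hrel a b k).1 hk
      refine ⟨c, d, e, fun p hp => ?_⟩
      rw [h p hp, hY]
      ext <;> simp <;> ring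
    · rintro ⟨c, d, e, h⟩
      refine ⟨e * a₀, e * b₀, e * k₀, c, d, fun p hp => ?_, (hrel _ _ _).2 ⟨e, rfl, rfl, rfl⟩⟩
      rw [h p hp, hY]
      ext <;> simp <;> ring

/-- Two points suffice to separate a nonconstant function from constants; three equally spaced ones
allow a second difference. -/
theorem exists_pos_lt_mem (hΩ : IsOpen Ω) (hpos : ∃ p ∈ Ω, 0 < p.2.2) :
    ∃ u ∈ uRange Ω, ∃ δ > 0, 0 < u ∧ u + δ ∈ uRange Ω ∧ u + 2 * δ ∈ uRange Ω := by
  obtain ⟨p, hp, hu⟩ := hpos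
  have hmem : p.2.2 ∈ uRange Ω := ⟨p, hp, rfl⟩
  obtain ⟨ε, hε, hball⟩ := Metric.isOpen_iff.1 (isOpen_uRange hΩ) _ hmem
  refine ⟨p.2.2, hmem, ε / 3, by positivity, hu, hball ?_, hball ?_⟩ <;>
  · rw [Metric.mem_ball, Real.dist_eq, add_sub_cancel_left, abs_of_pos (by positivity)]
    linarith

/-- A nonconstant function on `uRange Ω` is linearly independent of the constants. -/
theorem coeff_eq_zero {g : ℝ → ℝ} {A B u v : ℝ} (huv : g u ≠ g v) (hu : A * g u = B)
    (hv : A * g v = B) : A = 0 ∧ B = 0 := by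
  have : A = 0 := by
    have : A * (g u - g v) = 0 := by linear_combination hu - hv
    exact (mul_eq_zero.1 this).resolve_right (sub_ne_zero.2 huv)
  exact ⟨this, by rw [← hu, this, zero_mul]⟩

/-! ### Solving the relation for each form of `f`. -/

section
variable (hΩ : IsOpen Ω) {f : ℝ → ℝ}
include hΩ

theorem IsPower.derivs {n f₀ f₁ f₂ : ℝ} (h : IsPower Ω f n f₀ f₁ f₂) {u : ℝ}
    (hu : u ∈ uRange Ω) (hu0 : u ≠ 0) : deriv f u = f₀ * n * u ^ (n - 1) + f₁ ∧
      u * deriv (deriv f) u = f₀ * n * (n - 1) * u ^ (n - 1) := by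
  obtain ⟨h1, h2⟩ := derivs_eq_of_eqOn hΩ h.2.2 (F' := fun u => f₀ * n * u ^ (n - 1) + f₁)
    (F'' := fun u => f₀ * n * ((n - 1) * u ^ (n - 1 - 1))) (fun u hu => by
      refine ((((Real.hasDerivAt_rpow_const (Or.inl hu)).const_mul f₀).add
        ((hasDerivAt_id u).const_mul f₁)).add_const f₂).congr_deriv ?_
      ring) (fun u hu => ((Real.hasDerivAt_rpow_const (Or.inl hu)).const_mul (f₀ * n)).add_const f₁)
    hu hu0
  refine ⟨h1, ?_⟩
  rw [h2, Real.rpow_sub_one hu0 (n - 1)]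
  field_simp

theorem IsULog.derivs {f₀ f₁ f₂ : ℝ} (h : IsULog Ω f f₀ f₁ f₂) {u : ℝ}
    (hu : u ∈ uRange Ω) (hu0 : u ≠ 0) : deriv f u = f₀ * Real.log u + f₀ + f₁ ∧
      u * deriv (deriv f) u = f₀ := by
  obtain ⟨h1, h2⟩ := derivs_eq_of_eqOn hΩ h.2 (F' := fun u => f₀ * Real.log u + f₀ + f₁)
    (F'' := fun u => f₀ * u⁻¹) (fun u hu => by
      refine (((((hasDerivAt_id u).const_mul f₀).mul (Real.hasDerivAt_log hu)).add
        ((hasDerivAt_id u).const_mul f₁)).add_const f₂).congr_deriv ?_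
      simp only [id]
      field_simp) (fun u hu => (((Real.hasDerivAt_log hu).const_mul f₀).add_const f₀).add_const f₁)
    hu hu0
  refine ⟨h1, ?_⟩
  rw [h2]
  field_simp

theorem IsLog.derivs {f₀ f₁ f₂ : ℝ} (h : IsLog Ω f f₀ f₁ f₂) {u : ℝ}
    (hu : u ∈ uRange Ω) (hu0 : u ≠ 0) : deriv f u = f₀ * u⁻¹ + f₁ ∧
      u * deriv (deriv f) u = -(f₀ * u⁻¹) := by
  obtain ⟨h1, h2⟩ := derivs_eq_of_eqOn hΩ h.2 (F' := fun u => f₀ * u⁻¹ + f₁)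
    (F'' := fun u => f₀ * -(u ^ 2)⁻¹) (fun u hu => by
      refine ((((Real.hasDerivAt_log hu).const_mul f₀).add
        ((hasDerivAt_id u).const_mul f₁)).add_const f₂).congr_deriv ?_
      ring) (fun u hu => ((hasDerivAt_inv hu).const_mul f₀).add_const f₁)
    hu hu0
  refine ⟨h1, ?_⟩
  rw [h2]
  field_simp

variable (hf : ContDiffOn ℝ ∞ f (uRange Ω))
include hf

theorem IsPower.structureRelation {n f₀ f₁ f₂ : ℝ} (h : IsPower Ω f n f₀ f₁ f₂) (e : ℝ) :
    StructureRelation Ω f (e * -2) (e * (n - 3)) (e * (2 * f₁ * (n - 1))) :=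
  structureRelation_of_ne_zero hΩ hf fun u hu hu0 => by
    obtain ⟨h1, h2⟩ := h.derivs hΩ hu hu0
    rw [h1, h2]; ring

variable (hpos : ∃ p ∈ Ω, 0 < p.2.2)
include hpos

/-- For `n ≠ 1` the function `u^(n-1)` is injective on positive numbers, so its coefficient and the
constant term vanish separately. These two equations leave `a` free. -/
theorem IsPower.structureRelation_iff {n f₀ f₁ f₂ : ℝ} (h : IsPower Ω f n f₀ f₁ f₂) (hn : n ≠ 1)
    (a b k : ℝ) : StructureRelation Ω f a b k ↔
      ∃ e, a = e * -2 ∧ b = e * (n - 3) ∧ k = e * (2 * f₁ * (n - 1)) := by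
  refine ⟨fun hr => ?_, ?_⟩
  · obtain ⟨u, hu, δ, hδ, hu0, hv, -⟩ := exists_pos_lt_mem hΩ hpos
    have hv0 : 0 < u + δ := by linarith
    have hrel {u : ℝ} (hu : u ∈ uRange Ω) (hu0 : 0 < u) :
        f₀ * n * (2 * (b - a) + a * (n - 1)) * u ^ (n - 1) = k - 2 * (b - a) * f₁ := by
      have := hr u hu
      obtain ⟨h1, h2⟩ := h.derivs hΩ hu hu0.ne'
      rw [h1, h2] at this
      linear_combination this
    obtain ⟨h1, h2⟩ := coeff_eq_zero (g := fun u => u ^ (n - 1)) (u := u) (v := u + δ)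
      (fun he => by
        have := Real.rpow_left_injOn (sub_ne_zero.2 hn) hu0.le hv0.le he
        linarith) (hrel hu hu0) (hrel hv hv0)
    have h3 := (mul_eq_zero.1 h1).resolve_left (mul_ne_zero h.2.1 h.1)
    exact ⟨-a / 2, by ring, by linear_combination h3 / 2, by linear_combination h2 + f₁ * h3⟩
  · rintro ⟨e, rfl, rfl, rfl⟩
    exact h.structureRelation hΩ hf e

theorem IsULog.structureRelation_iff {f₀ f₁ f₂ : ℝ} (h : IsULog Ω f f₀ f₁ f₂) (a b k : ℝ) :
    StructureRelation Ω f a b k ↔ ∃ e, a = e * 1 ∧ b = e * 1 ∧ k = e * f₀ := by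
  refine ⟨fun hr => ?_, ?_⟩
  · obtain ⟨u, hu, δ, hδ, hu0, hv, -⟩ := exists_pos_lt_mem hΩ hpos
    have hv0 : 0 < u + δ := by linarith
    have hrel {u : ℝ} (hu : u ∈ uRange Ω) (hu0 : 0 < u) :
        2 * (b - a) * f₀ * Real.log u = k - a * f₀ - 2 * (b - a) * (f₀ + f₁) := by
      have := hr u hu
      obtain ⟨h1, h2⟩ := h.derivs hΩ hu hu0.ne'
      rw [h1, h2] at this
      linear_combination this
    obtain ⟨h1, h2⟩ := coeff_eq_zero (g := Real.log) (u := u) (v := u + δ)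
      (fun he => by
        have := Real.log_injOn_pos hu0 hv0 he
        linarith) (hrel hu hu0) (hrel hv hv0)
    have h3 := (mul_eq_zero.1 h1).resolve_right h.1
    exact ⟨a, by ring, by linear_combination h3 / 2, by linear_combination h2 + (f₀ + f₁) * h3⟩
  · rintro ⟨e, rfl, rfl, rfl⟩
    refine structureRelation_of_ne_zero hΩ hf fun u hu hu0 => ?_
    obtain ⟨h1, h2⟩ := h.derivs hΩ hu hu0
    rw [h1, h2]; ring

theorem IsLog.structureRelation_iff {f₀ f₁ f₂ : ℝ} (h : IsLog Ω f f₀ f₁ f₂) (a b k : ℝ) :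
    StructureRelation Ω f a b k ↔ ∃ e, a = e * 2 ∧ b = e * 3 ∧ k = e * (2 * f₁) := by
  refine ⟨fun hr => ?_, ?_⟩
  · obtain ⟨u, hu, δ, hδ, hu0, hv, -⟩ := exists_pos_lt_mem hΩ hpos
    have hv0 : 0 < u + δ := by linarith
    have hrel {u : ℝ} (hu : u ∈ uRange Ω) (hu0 : 0 < u) :
        (2 * b - 3 * a) * f₀ * u⁻¹ = k - 2 * (b - a) * f₁ := by
      have := hr u hu
      obtain ⟨h1, h2⟩ := h.derivs hΩ hu hu0.ne'
      rw [h1, h2] at this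
      linear_combination this
    obtain ⟨h1, h2⟩ := coeff_eq_zero (g := fun u => u⁻¹) (u := u) (v := u + δ)
      (fun he => by
        have := inv_injective he
        linarith) (hrel hu hu0) (hrel hv hv0)
    have h3 := (mul_eq_zero.1 h1).resolve_right h.1
    exact ⟨a / 2, by ring, by linear_combination h3 / 2, by linear_combination h2 + f₁ * h3⟩
  · rintro ⟨e, rfl, rfl, rfl⟩
    refine structureRelation_of_ne_zero hΩ hf fun u hu hu0 => ?_
    obtain ⟨h1, h2⟩ := h.derivs hΩ hu hu0
    rw [h1, h2]; ring

theorem IsPower.isPointSymmetry_X₃ {n f₀ f₁ f₂ : ℝ} (h : IsPower Ω f n f₀ f₁ f₂) :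
    IsPointSymmetry f Ω (X₃ n f₁) ∧ X₃ n f₁ ∉ generatedOn Ω {X₁, X₂} := by
  constructor
  · refine IsAffineOn.isPointSymmetry hΩ hf (a := 1 * -2) (c := 0) (d := 0) (fun p _ => ?_)
      (h.structureRelation hΩ hf 1)
    ext <;> simp only [X₃] <;> ring
  · rw [mem_generatedOn_pair]
    rintro ⟨c, d, h⟩
    obtain ⟨p, hp, hu⟩ := hpos
    have := congrArg (fun q : Pt => q.2.2) (h p hp)
    simp [X₃, hu.ne'] at this

/-- With `f' = f₀` constant the relation is only `k = 2(b - a) f₀`, which leaves both `a` and `b`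
free. -/
theorem IsPower.generatedOn_linear (hconn : IsConnected Ω) {f₀ f₂ : ℝ}
    (h : IsPower Ω f 1 f₀ 0 f₂) :
    X₄ f₀ ∉ generatedOn Ω {X₁, X₂, X₃ 1 0} ∧
      {X | IsPointSymmetry f Ω X} = generatedOn Ω {X₁, X₂, X₃ 1 0, X₄ f₀} := by
  constructor
  · rw [mem_generatedOn_triple]
    rintro ⟨c, d, e, h⟩
    obtain ⟨p, hp, hu⟩ := hpos
    have hc : ContinuousAt (fun t : ℝ => p + t • eT) 0 := by fun_prop
    have hm := hc.preimage_mem_nhds (hΩ.mem_nhds (by simpa using hp))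
    -- Comparing `∂_t` components at two times forces `e = 0`, whereas the `∂_u` component at `p`
    -- forces `2e = -3`.
    obtain ⟨t, ht, ht0⟩ := (Filter.Eventually.and (mem_nhdsWithin_of_mem_nhds hm)
      (self_mem_nhdsWithin : {(0 : ℝ)}ᶜ ∈ nhdsWithin 0 {0}ᶜ)).exists
    have h1 := congrArg (fun q : Pt => q.2.2) (h p hp)
    have h2 := congrArg (fun q : Pt => q.1) (h p hp)
    have h3 := congrArg (fun q : Pt => q.1) (h _ ht)
    simp only [X₃, X₄, Prod.snd_add, Prod.fst_add, Prod.smul_fst, Prod.smul_snd, smul_eq_mul]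
      at h1 h2 h3
    have h4 : (2 * e + 3) * p.2.2 = 0 := by linear_combination h1
    have h5 := (mul_eq_zero.1 h4).resolve_right hu.ne'
    refine ht0 ?_
    have h6 : e * t = 0 := by linear_combination (h3 - h2) / 2
    refine (mul_eq_zero.1 h6).resolve_left fun he => ?_
    rw [he] at h5; norm_num at h5
  · ext X
    rw [Set.mem_ofPred_eq, isPointSymmetry_iff hΩ hf hconn, mem_generatedOn_quadruple]
    constructor
    · rintro ⟨a, b, k, c, d, hX, hk⟩
      obtain ⟨u, hu, -, -, hu0, -⟩ := exists_pos_lt_mem hΩ hpos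
      obtain ⟨h1, h2⟩ := h.derivs hΩ hu hu0.ne'
      have h3 := hk u hu
      rw [h1, h2] at h3
      simp only [sub_self, Real.rpow_zero] at h3
      have h4 : k = 2 * (b - a) * f₀ := by linear_combination -h3
      -- The multipliers solve `-2e = 3b - 2a` and `-2e + 2g = b`; then `-2e + 3g = a` holds as
      -- well.
      refine ⟨c, d, a - 3 / 2 * b, a - b, fun p hp => ?_⟩
      rw [hX p hp, h4]
      ext <;> simp [X₃, X₄] <;> ring
    · rintro ⟨c, d, e, g, hX⟩
      refine ⟨-2 * e + 3 * g, -2 * e + 2 * g, -2 * g * f₀, c, d, fun p hp => ?_,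
        structureRelation_of_ne_zero hΩ hf fun u hu hu0 => ?_⟩
      · rw [hX p hp]
        ext <;> simp [X₃, X₄] <;> ring
      · obtain ⟨h1, h2⟩ := h.derivs hΩ hu hu0
        rw [h1, h2]
        simp only [sub_self, Real.rpow_zero]
        ring

end

/-! ### The classification. -/

theorem isPointSymmetry_of_mem_generatedOn_pair (hΩ : IsOpen Ω) {f : ℝ → ℝ}
    (hf : ContDiffOn ℝ ∞ f (uRange Ω)) {X : Pt → Pt} (hX : X ∈ generatedOn Ω {X₁, X₂}) :
    IsPointSymmetry f Ω X := by
  obtain ⟨c, d, h⟩ := mem_generatedOn_pair.1 hX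
  refine IsAffineOn.isPointSymmetry hΩ hf (a := 0) (b := 0) (k := 0) (c := c) (d := d)
    (fun p hp => ?_) (fun u _ => by ring)
  rw [h p hp]; simp

/-- One test equation suffices: for `f = u² + u³` the relation is `(4b - 2a) u + 6b u² = k`, which
forces `a = b = k = 0`. -/
theorem setOf_forall_isPointSymmetry (hΩ : IsOpen Ω) (hconn : IsConnected Ω)
    (hpos : ∃ p ∈ Ω, 0 < p.2.2) :
    {X | ∀ f, Admissible Ω f → IsPointSymmetry f Ω X} = generatedOn Ω {X₁, X₂} := by
  refine Set.Subset.antisymm (fun X hX => ?_)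
    (fun X hX f hf => isPointSymmetry_of_mem_generatedOn_pair hΩ hf.1 hX)
  obtain ⟨u, hu, δ, hδ, hu0, hv, hw⟩ := exists_pos_lt_mem hΩ hpos
  have hd : deriv (fun u : ℝ => u ^ 2 + u ^ 3) = fun u => 2 * u + 3 * u ^ 2 := by
    ext u
    simp
  have hd2 : deriv (fun u : ℝ => 2 * u + 3 * u ^ 2) = fun u => 2 + 6 * u := by
    ext u
    refine (((hasDerivAt_id u).const_mul 2).add ((hasDerivAt_pow 2 u).const_mul 3)).deriv.trans ?_
    simp; ring
  have hf : Admissible Ω fun u : ℝ => u ^ 2 + u ^ 3 :=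
    ⟨ContDiff.contDiffOn (by fun_prop), u, hu, by rw [hd]; positivity⟩
  obtain ⟨a, b, k, c, d, h, hk⟩ := (isPointSymmetry_iff hΩ hf.1 hconn).1 (hX _ hf)
  simp only [hd, hd2] at hk
  have h1 := hk u hu
  have h2 := hk _ hv
  have h3 := hk _ hw
  -- The second difference of the quadratic polynomial is `12 b δ²`.
  have e1 : b * δ ^ 2 = 0 := by linear_combination (h1 - 2 * h2 + h3) / 12
  have hb : b = 0 := (mul_eq_zero.1 e1).resolve_right (by positivity)
  subst hb
  have e2 : a * δ = 0 := by linear_combination (h1 - h2) / 2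
  have ha : a = 0 := (mul_eq_zero.1 e2).resolve_right hδ.ne'
  subst ha
  have hk0 : k = 0 := by linear_combination -h1
  subst hk0
  exact mem_generatedOn_pair.2 ⟨c, d, fun p hp => by rw [h p hp]; simp⟩

theorem exists_form_of_isPointSymmetry (hΩ : IsOpen Ω) (hconn : IsConnected Ω)
    (hpos : ∃ p ∈ Ω, 0 < p.2.2) {f : ℝ → ℝ} (hf : Admissible Ω f) {X : Pt → Pt}
    (hX : IsPointSymmetry f Ω X) (hXn : X ∉ generatedOn Ω {X₁, X₂}) :
    (∃ n f₀ f₁ f₂ : ℝ, IsPower Ω f n f₀ f₁ f₂) ∨ (∃ f₀ f₁ f₂ : ℝ, IsULog Ω f f₀ f₁ f₂) ∨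
      (∃ f₀ f₁ f₂ : ℝ, IsLog Ω f f₀ f₁ f₂) := by
  obtain ⟨a, b, k, c, d, h, hk⟩ := (isPointSymmetry_iff hΩ hf.1 hconn).1 hX
  obtain ⟨p, hp, hu⟩ := hpos
  refine exists_form_of_structureRelation hΩ hconn hf ⟨_, ⟨p, hp, rfl⟩, hu⟩ hk ?_
  rintro ⟨rfl, rfl, rfl⟩
  exact hXn (mem_generatedOn_pair.2 ⟨c, d, fun p hp => by rw [h p hp]; simp⟩)

theorem IsULog.symmetries (hΩ : IsOpen Ω) (hconn : IsConnected Ω) (hpos : ∃ p ∈ Ω, 0 < p.2.2)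
    {f : ℝ → ℝ} (hf : ContDiffOn ℝ ∞ f (uRange Ω)) {f₀ f₁ f₂ : ℝ} (h : IsULog Ω f f₀ f₁ f₂) :
    X₅ f₀ ∉ generatedOn Ω {X₁, X₂} ∧
      {X | IsPointSymmetry f Ω X} = generatedOn Ω {X₁, X₂, X₅ f₀} :=
  generatedOn_of_structureRelation_iff hΩ hconn hpos hf one_ne_zero
    (fun p => by ext <;> simp only [X₅] <;> ring) (h.structureRelation_iff hΩ hf hpos)

theorem IsLog.symmetries (hΩ : IsOpen Ω) (hconn : IsConnected Ω) (hpos : ∃ p ∈ Ω, 0 < p.2.2)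
    {f : ℝ → ℝ} (hf : ContDiffOn ℝ ∞ f (uRange Ω)) {f₀ f₁ f₂ : ℝ} (h : IsLog Ω f f₀ f₁ f₂) :
    X₆ f₁ ∉ generatedOn Ω {X₁, X₂} ∧
      {X | IsPointSymmetry f Ω X} = generatedOn Ω {X₁, X₂, X₆ f₁} :=
  generatedOn_of_structureRelation_iff hΩ hconn hpos hf two_ne_zero
    (fun p => by ext <;> simp only [X₆] <;> ring) (h.structureRelation_iff hΩ hf hpos)

end

end QuasilinearKdV

theorem theorem1 (Ω : Set QuasilinearKdV.Pt) (hΩ : IsOpen Ω) (hconn : IsConnected Ω)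
    (hpos : ∃ p ∈ Ω, 0 < p.2.2) :
    -- the symmetries common to all equations of the class
    ({X | ∀ f, QuasilinearKdV.Admissible Ω f → QuasilinearKdV.IsPointSymmetry f Ω X}
      = QuasilinearKdV.generatedOn Ω {QuasilinearKdV.X₁, QuasilinearKdV.X₂}) ∧
    ∀ f : ℝ → ℝ, QuasilinearKdV.Admissible Ω f →
      -- there are further symmetries exactly in the three listed cases
      ((∃ X, QuasilinearKdV.IsPointSymmetry f Ω X ∧
            X ∉ QuasilinearKdV.generatedOn Ω {QuasilinearKdV.X₁, QuasilinearKdV.X₂}) ↔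
        ((∃ n f₀ f₁ f₂ : ℝ, QuasilinearKdV.IsPower Ω f n f₀ f₁ f₂) ∨
         (∃ f₀ f₁ f₂ : ℝ, QuasilinearKdV.IsULog Ω f f₀ f₁ f₂) ∨
         (∃ f₀ f₁ f₂ : ℝ, QuasilinearKdV.IsLog Ω f f₀ f₁ f₂))) ∧
      -- power case
      (∀ n f₀ f₁ f₂ : ℝ, QuasilinearKdV.IsPower Ω f n f₀ f₁ f₂ →
        QuasilinearKdV.IsPointSymmetry f Ω (QuasilinearKdV.X₃ n f₁) ∧
        QuasilinearKdV.X₃ n f₁ ∉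
          QuasilinearKdV.generatedOn Ω {QuasilinearKdV.X₁, QuasilinearKdV.X₂} ∧
        (n ≠ 1 →
          {X | QuasilinearKdV.IsPointSymmetry f Ω X}
            = QuasilinearKdV.generatedOn Ω
                {QuasilinearKdV.X₁, QuasilinearKdV.X₂, QuasilinearKdV.X₃ n f₁}) ∧
        (n = 1 → f₁ = 0 →
          QuasilinearKdV.X₄ f₀ ∉ QuasilinearKdV.generatedOn Ω
              {QuasilinearKdV.X₁, QuasilinearKdV.X₂, QuasilinearKdV.X₃ n f₁} ∧
          {X | QuasilinearKdV.IsPointSymmetry f Ω X}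
            = QuasilinearKdV.generatedOn Ω
                {QuasilinearKdV.X₁, QuasilinearKdV.X₂, QuasilinearKdV.X₃ n f₁,
                  QuasilinearKdV.X₄ f₀})) ∧
      -- case `u ln u`
      (∀ f₀ f₁ f₂ : ℝ, QuasilinearKdV.IsULog Ω f f₀ f₁ f₂ →
        QuasilinearKdV.X₅ f₀ ∉
          QuasilinearKdV.generatedOn Ω {QuasilinearKdV.X₁, QuasilinearKdV.X₂} ∧
        {X | QuasilinearKdV.IsPointSymmetry f Ω X}
          = QuasilinearKdV.generatedOn Ω
              {QuasilinearKdV.X₁, QuasilinearKdV.X₂, QuasilinearKdV.X₅ f₀}) ∧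
      -- case `ln u`
      (∀ f₀ f₁ f₂ : ℝ, QuasilinearKdV.IsLog Ω f f₀ f₁ f₂ →
        QuasilinearKdV.X₆ f₁ ∉
          QuasilinearKdV.generatedOn Ω {QuasilinearKdV.X₁, QuasilinearKdV.X₂} ∧
        {X | QuasilinearKdV.IsPointSymmetry f Ω X}
          = QuasilinearKdV.generatedOn Ω
              {QuasilinearKdV.X₁, QuasilinearKdV.X₂, QuasilinearKdV.X₆ f₁}) := by
  open QuasilinearKdV in
  refine ⟨setOf_forall_isPointSymmetry hΩ hconn hpos, fun f hf => ⟨⟨?_, ?_⟩, ?_, ?_, ?_⟩⟩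
  · rintro ⟨X, hX, hXn⟩
    exact exists_form_of_isPointSymmetry hΩ hconn hpos hf hX hXn
  · rintro (⟨n, f₀, f₁, f₂, h⟩ | ⟨f₀, f₁, f₂, h⟩ | ⟨f₀, f₁, f₂, h⟩)
    · exact ⟨_, h.isPointSymmetry_X₃ hΩ hf.1 hpos⟩
    · obtain ⟨h1, h2⟩ := h.symmetries hΩ hconn hpos hf.1
      exact ⟨_, h2.ge (mem_generatedOn_triple.2 ⟨0, 0, 1, fun p _ => by simp⟩), h1⟩
    · obtain ⟨h1, h2⟩ := h.symmetries hΩ hconn hpos hf.1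
      exact ⟨_, h2.ge (mem_generatedOn_triple.2 ⟨0, 0, 1, fun p _ => by simp⟩), h1⟩
  · intro n f₀ f₁ f₂ h
    obtain ⟨h1, h2⟩ := h.isPointSymmetry_X₃ hΩ hf.1 hpos
    refine ⟨h1, h2, fun hn => ?_, ?_⟩
    · exact (generatedOn_of_structureRelation_iff hΩ hconn hpos hf.1 (by norm_num)
        (fun p => by ext <;> simp only [X₃] <;> ring) (h.structureRelation_iff hΩ hf.1 hpos hn)).2
    · rintro rfl rfl
      exact h.generatedOn_linear hΩ hf.1 hpos hconn
  · exact fun f₀ f₁ f₂ h => h.symmetries hΩ hconn hpos hf.1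
  · exact fun f₀ f₁ f₂ h => h.symmetries hΩ hconn hpos hf.1
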